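/- Let $F$ be a definite quaternion algebra over $\mathbf{Q}$, i.e. a skew field with center $\mathbf{Q}$, of dimension $4$ over $\mathbf{Q}$, such that $F\otimes_{\mathbf{Q}}\mathbf{R}$ is isomorphic to Hamilton's quaternions, and let $x\mapsto\bar x$ be its canonical involution. Let $(A,E)$ be a polarized complex abelian variety of dimension $2n$, of quaternion type with algebra $F$; that is, there is an inclusion of $\mathbf{Q}$-algebras $F\subset \mathrm{End}(A)\otimes\mathbf{Q}$ (so that $H_1(A,\mathbf{Q})$ is a vector space over $F$) such that $x^*E=x\bar x\,E$ for all $x\in F$. The elements $x\in F$ act on $H^{2n}(A,\mathbf{Q})=\wedge^{2n}H^1(A,\mathbf{Q})$ through $\wedge^{2n}$ of their action on $H^1(A,\mathbf{Q})$. For a quadratic subfield $K\subset F$ with complex embeddings $\sigma,\bar\sigma$ and for $x\in K$, let $f_x=(T-\sigma(x)^{2n})(T-\bar\sigma(x)^{2n})\in\mathbf{Q}[T]$, let $W_x\subset H^{2n}(A,\mathbf{Q})$ be the kernel of $f_x$ evaluated at the action of $x$ on $H^{2n}(A,\mathbf{Q})$, and let $$W_K=\bigcap_{x\in K}W_x\subset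 H^{2n}(A,\mathbf{Q})$$ be the space of Weil classes for $K$. Let $W_F\subset H^{2n}(A,\mathbf{Q})$ be the $\mathbf{Q}$-subspace spanned by the translates $x\cdot W_K$, where $x$ runs over $F$. Then $W_F$ does not depend on the choice of the quadratic subfield $K\subset F$, and $$W_F\subset H^{2n}(A,\mathbf{Q})\cap H^{n,n}(A),\qquad \dim_{\mathbf{Q}}W_F=2n+1.$$ -/

import Mathlib

open scoped TensorProduct

noncomputable section

/-! ### Definite quaternion algebras over `ℚ` -/

/-- A definite quaternion algebra over `ℚ`: a skew field with centre `ℚ`, of dimension `4` over `ℚ`,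
such that `ℝ ⊗ F` is isomorphic to Hamilton's quaternions. -/
structure IsDefiniteQuaternionAlgebra (F : Type*) [Ring F] [Algebra ℚ F] : Prop where
  isUnit_of_ne_zero : ∀ x : F, x ≠ 0 → IsUnit x
  isCentral : Algebra.IsCentral ℚ F
  finrank_eq : Module.finrank ℚ F = 4
  definite : Nonempty ((ℝ ⊗[ℚ] F) ≃ₐ[ℝ] Quaternion ℝ)

/-- The canonical involution `x ↦ x̄ = trd x - x` of a quaternion algebra. The reduced trace `trd x`
is half of the trace of multiplication by `x` on the four-dimensional space `F`; for
`x = a + b i + c j + d k` this gives `x̄ = a - b i - c j - d k`. -/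
def quaternionConj {F : Type*} [Ring F] [Algebra ℚ F] (x : F) : F :=
  algebraMap ℚ F (LinearMap.trace ℚ F (LinearMap.mulLeft ℚ x) / 2) - x

/-- A subfield of `F` which is a quadratic extension of `ℚ`. -/
structure IsQuadraticSubfield {F : Type*} [Ring F] [Algebra ℚ F] (K : Subalgebra ℚ F) : Prop where
  isField : IsField K
  finrank_eq : Module.finrank ℚ K = 2

/-! ### Complex tori `A = V / Λ`, their endomorphisms and polarizations -/

section Torus

variable {V : Type*} [NormedAddCommGroup V] [NormedSpace ℂ V] (Λ : Submodule ℤ V)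

/-- `End(A)` for the complex torus `A = V / Λ`: the `ℂ`-linear endomorphisms of the tangent space
`V = T₀A` that map the lattice `Λ` into itself. -/
def torusEnd : Subring (Module.End ℂ V) where
  carrier := {φ | ∀ v ∈ Λ, φ v ∈ Λ}
  mul_mem' := fun ha hb v hv => ha _ (hb v hv)
  one_mem' := fun _ hv => hv
  add_mem' := fun ha hb v hv => Λ.add_mem (ha v hv) (hb v hv)
  zero_mem' := fun _ _ => Λ.zero_mem
  neg_mem' := fun ha v hv => Λ.neg_mem (ha v hv)

/-- `End(A) ⊗ ℚ`. -/
abbrev torusEndQ : Type _ := ℚ ⊗[ℤ] torusEnd Λ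

/-- `H₁(A, ℚ) = ℚ ⊗ H₁(A, ℤ)` with `H₁(A, ℤ) = Λ`. -/
abbrev torusH1Q : Type _ := ℚ ⊗[ℤ] Λ

/-- The action of `End(A)` on `H₁(A, ℤ) = Λ`. -/
def integralRep : torusEnd Λ →ₐ[ℤ] Module.End ℤ Λ :=
  RingHom.toIntAlgHom
    { toFun := fun φ => (φ.1.restrictScalars ℤ).restrict φ.2
      map_one' := rfl
      map_mul' := fun _ _ => rfl
      map_zero' := rfl
      map_add' := fun _ _ => rfl }

/-- The action of `End(A) ⊗ ℚ` on `H₁(A, ℚ)`, where `q ⊗ φ` sends `r ⊗ v` to `q r ⊗ φ v`. -/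
def rationalRep : torusEndQ Λ →ₐ[ℚ] Module.End ℚ (torusH1Q Λ) :=
  Algebra.TensorProduct.lift (Algebra.ofId ℚ _)
    ((Module.End.baseChangeHom ℤ ℚ Λ).comp (integralRep Λ))
    (fun q _ => Algebra.commutes q _)

/-- A polarization of `A = V / Λ`: a Riemann form, that is, an alternating form `E` with integral
values on `Λ` whose real-bilinear extension to `V` satisfies `E(iv, iw) = E(v, w)` and
`E(v, iv) > 0` for `v ≠ 0`. -/
structure Polarization where
  form : LinearMap.BilinForm ℤ Λ
  realForm : LinearMap.BilinForm ℝ V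
  realForm_coe : ∀ v w : Λ, realForm v w = (form v w : ℝ)
  alternating : realForm.IsAlt
  map_I : ∀ v w : V, realForm (Complex.I • v) (Complex.I • w) = realForm v w
  pos : ∀ v : V, v ≠ 0 → 0 < realForm v (Complex.I • v)

variable {Λ}

/-- `E` as a form on `H₁(A, ℚ)`. -/
def Polarization.formQ (E : Polarization Λ) : LinearMap.BilinForm ℚ (torusH1Q Λ) :=
  E.form.baseChange ℚ

/-- `(A, E, F)` is a polarized abelian variety of quaternion type, where `ι` is the inclusion
`F ⊂ End(A) ⊗ ℚ`: `F` is a definite quaternion algebra and `x^* E = x x̄ E` for all `x ∈ F`.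
(Since `ι` is unital, `H₁(A, ℚ)` is a vector space over `F`.) -/
structure IsQuaternionType (E : Polarization Λ) {F : Type*} [Ring F] [Algebra ℚ F]
    (ι : F →ₐ[ℚ] torusEndQ Λ) : Prop where
  definite : IsDefiniteQuaternionAlgebra F
  injective : Function.Injective ι
  pullback_form : ∀ (x : F) (c : ℚ), algebraMap ℚ F c = x * quaternionConj x →
    ∀ v w : torusH1Q Λ,
      E.formQ (rationalRep Λ (ι x) v) (rationalRep Λ (ι x) w) = c * E.formQ v w

variable (Λ)

/-! ### Cohomology of `A = V / Λ` and its Hodge decomposition -/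

/-- `H¹(A, ℚ)`, the dual of `H₁(A, ℚ)`. -/
abbrev torusCohQ1 : Type _ := Module.Dual ℚ (torusH1Q Λ)

/-- `H^k(A, ℚ) = ⋀^k H¹(A, ℚ)`. -/
abbrev torusCohQ (k : ℕ) : Type _ := ⋀[ℚ]^k (torusCohQ1 Λ)

/-- `H¹(A, ℂ) = Hom(Λ, ℂ)`. -/
abbrev torusCohC1 : Type _ := Λ →ₗ[ℤ] ℂ

/-- `H^k(A, ℂ) = ⋀^k H¹(A, ℂ)`. -/
abbrev torusCohC (k : ℕ) : Type _ := ⋀[ℂ]^k (torusCohC1 Λ)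

/-- The inclusion `H¹(A, ℚ) → H¹(A, ℂ)`. -/
def cohQ1ToC1 : torusCohQ1 Λ →ₗ[ℚ] torusCohC1 Λ where
  toFun f :=
    { toFun := fun v => ((f (1 ⊗ₜ v) : ℚ) : ℂ)
      map_add' := fun v w => by simp [TensorProduct.tmul_add]
      map_smul' := fun m v => by
        rw [TensorProduct.tmul_smul, map_zsmul]
        simp }
  map_add' f g := by ext v; simp
  map_smul' q f := by ext v; simp [Algebra.smul_def]

/-- The natural map `H^k(A, ℚ) → H^k(A, ℂ)`, sending `f₁ ∧ ⋯ ∧ f_k` to `f₁ ∧ ⋯ ∧ f_k`. -/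
def cohQToC (k : ℕ) : torusCohQ Λ k →ₗ[ℚ] torusCohC Λ k :=
  exteriorPower.alternatingMapLinearEquiv
    { ((exteriorPower.ιMulti ℂ k (M := torusCohC1 Λ)).toMultilinearMap.restrictScalars
        ℚ).compLinearMap (fun _ => cohQ1ToC1 Λ) with
      map_eq_zero_of_eq' := fun v _ _ hv hij =>
        (exteriorPower.ιMulti ℂ k (M := torusCohC1 Λ)).map_eq_zero_of_eq
          (fun l => cohQ1ToC1 Λ (v l)) (congrArg (cohQ1ToC1 Λ) hv) hij }

/-- `H^{1,0}(A) ⊂ H¹(A, ℂ)`: the restrictions to `Λ` of the `ℂ`-linear functionals on `V = T₀A`. -/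
def hodge10 : Submodule ℂ (torusCohC1 Λ) where
  carrier := {f | ∃ g : V →ₗ[ℂ] ℂ, ∀ v : Λ, f v = g v}
  add_mem' := by
    rintro _ _ ⟨g, hg⟩ ⟨g', hg'⟩
    exact ⟨g + g', fun v => by simp [hg, hg']⟩
  zero_mem' := ⟨0, fun v => by simp⟩
  smul_mem' := by
    rintro c _ ⟨g, hg⟩
    exact ⟨c • g, fun v => by simp [hg]⟩

/-- `H^{0,1}(A) ⊂ H¹(A, ℂ)`: the restrictions to `Λ` of the conjugate-linear functionals on `V`. -/
def hodge01 : Submodule ℂ (torusCohC1 Λ) where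
  carrier := {f | ∃ g : V →ₛₗ[starRingEnd ℂ] ℂ, ∀ v : Λ, f v = g v}
  add_mem' := by
    rintro _ _ ⟨g, hg⟩ ⟨g', hg'⟩
    exact ⟨g + g', fun v => by simp [hg, hg']⟩
  zero_mem' := ⟨0, fun v => by simp⟩
  smul_mem' := by
    rintro c _ ⟨g, hg⟩
    exact ⟨c • g, fun v => by simp [hg]⟩

/-- `H^{p,q}(A) ⊂ H^k(A, ℂ)` for `p + q = k`: the span of the products `a₁ ∧ ⋯ ∧ a_p ∧ b₁ ∧ ⋯ ∧ b_q`
with all `a_i` in `H^{1,0}(A)` and all `b_j` in `H^{0,1}(A)`. -/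
def hodgePiece (p q : ℕ) {k : ℕ} (_hk : p + q = k) : Submodule ℂ (torusCohC Λ k) :=
  Submodule.span ℂ {ω | ∃ v : Fin k → torusCohC1 Λ,
    (∀ i : Fin k, (i : ℕ) < p → v i ∈ hodge10 Λ) ∧
    (∀ i : Fin k, p ≤ (i : ℕ) → v i ∈ hodge01 Λ) ∧
    ω = exteriorPower.ιMulti ℂ k v}

/-! ### Weil classes and quaternion classes -/

variable {Λ}

/-- The action `⋀^k x^*` of `x ∈ End(A) ⊗ ℚ` on `H^k(A, ℚ) = ⋀^k H¹(A, ℚ)`, where `x^*` is the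
transpose of the action of `x` on `H₁(A, ℚ)`. -/
def cohAction (k : ℕ) (x : torusEndQ Λ) : Module.End ℚ (torusCohQ Λ k) :=
  exteriorPower.map k (rationalRep Λ x).dualMap

variable {F : Type*} [Ring F] [Algebra ℚ F]

/-- `W_x ⊂ H^{2n}(A, ℚ)` for `x` in a quadratic field `K ⊂ F`: the kernel of `f(x)`, where
`f = (T - σ(x)^{2n}) (T - σ̄(x)^{2n}) = T² - Tr_{K/ℚ}(x^{2n}) T + N_{K/ℚ}(x^{2n})` and `σ`, `σ̄` are the
complex embeddings of `K`. Trace and norm are those of multiplication by `x^{2n}` on `K`. -/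
def weilKernel (ι : F →ₐ[ℚ] torusEndQ Λ) (n : ℕ) (K : Subalgebra ℚ F) (x : K) :
    Submodule ℚ (torusCohQ Λ (2 * n)) :=
  LinearMap.ker
    (cohAction (2 * n) (ι x) ^ 2
      - LinearMap.trace ℚ K (LinearMap.mulLeft ℚ (x ^ (2 * n))) • cohAction (2 * n) (ι x)
      + LinearMap.det (LinearMap.mulLeft ℚ (x ^ (2 * n))) • (1 : Module.End ℚ (torusCohQ Λ (2 * n))))

/-- The space of Weil classes `W_K = ⋂_{x ∈ K} W_x ⊂ H^{2n}(A, ℚ)`. -/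
def weilClasses (ι : F →ₐ[ℚ] torusEndQ Λ) (n : ℕ) (K : Subalgebra ℚ F) :
    Submodule ℚ (torusCohQ Λ (2 * n)) :=
  ⨅ x : K, weilKernel ι n K x

/-- The space of quaternion classes `W_F ⊂ H^{2n}(A, ℚ)` defined by means of `K ⊂ F`: the span of
the translates `x · W_K` for `x ∈ F`. -/
def quaternionClasses (ι : F →ₐ[ℚ] torusEndQ Λ) (n : ℕ) (K : Subalgebra ℚ F) :
    Submodule ℚ (torusCohQ Λ (2 * n)) :=
  ⨆ x : F, (weilClasses ι n K).map (cohAction (2 * n) (ι x))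

end Torus

end

set_option linter.unusedSectionVars false

noncomputable section

/-! ### Base change of vector spaces along a field extension -/

section BaseChange

variable {k L M N : Type*} [Field k] [Field L] [Algebra k L] [AddCommGroup M] [Module k M]
  [AddCommGroup N] [Module k N] [Module L N] [IsScalarTower k L N]

/-! Everything is computed after extension of scalars to `ℂ`, where `F` becomes a `2 × 2` matrix
algebra, and then descended to `ℚ`.

Write a quadratic subfield as `K = ℚ(a)` with `a² = d = s²`, and take a unit `b` anticommuting with
`a` (`exists_isQuaternionPair`). On `H¹(A, ℂ)`, of dimension `4n`, `F` acts by pullback, and `b`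
exchanges the eigenspaces of `a` for `s` and `-s`, so each has dimension `2n`. If `eᵢ` is a basis of
the first and `fᵢ = b eᵢ`, then `F` acts on every plane `⟨eᵢ, fᵢ⟩` by the same matrices. Over `ℂ`
the Weil classes are spanned by `⋀ eᵢ` and `⋀ fᵢ`, because a suitable `t + a` separates these from
all mixed products (`span_cohQToC_weilClasses`). An element of `F` sends them to products `⋀ (α eᵢ +
β fᵢ)`, and these products span `W_F ⊗ ℂ` (`span_cohQToC_quaternionClasses`). Such a pencil is a
copy of the binary forms of degree `2n`, of dimension `2n + 1` (`finrank_pencilSpan`).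

For another field `ℚ(a')`, the eigenvectors of `a'` are `α eᵢ + β fᵢ` with `α, β` independent of
`i`, so its Weil classes lie in the same pencil (`weilClasses_le_quaternionClasses`). For the Hodge
type, `F` preserves `H^{1,0}` and `H^{0,1}`, so half of the `eᵢ` can be taken in each
(`exists_hodge_eigenvectors`); every member of the pencil is then a product of `n` forms of each
type. -/

/-- A linear map that carries a basis to a basis exhibits its target as a base change. -/
theorem IsBaseChange.of_map_basis {I : Type*} {f : M →ₗ[k] N} (b : Module.Basis I k M)
    (b' : Module.Basis I L N) (h : ∀ i, f (b i) = b' i) : IsBaseChange L f := by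
  refine IsBaseChange.of_equiv ((b.baseChange L).equiv b' (Equiv.refl I)) fun x => ?_
  have key : ((((b.baseChange L).equiv b' (Equiv.refl I)).toLinearMap.restrictScalars k) ∘ₗ
      TensorProduct.mk k L M 1) = f := by
    refine b.ext fun i => ?_
    have := (b.baseChange L).equiv_apply (b' := b') i (Equiv.refl I)
    rw [Module.Basis.baseChange_apply] at this
    simpa [h] using this
  exact LinearMap.congr_fun key x

variable {f : M →ₗ[k] N}

/-- By flatness `L ⊗ W` injects into `N`, and its image is the span. -/
theorem IsBaseChange.finrank_span_image (hf : IsBaseChange L f) (W : Submodule k M) :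
    Module.finrank L (Submodule.span L (f '' W)) = Module.finrank k W := by
  let g : L ⊗[k] W →ₗ[L] N := hf.equiv.toLinearMap ∘ₗ W.subtype.baseChange L
  have hg : Function.Injective g := by
    refine hf.equiv.injective.comp ?_
    exact Module.Flat.lTensor_preserves_injective_linearMap W.subtype W.injective_subtype
  have hr : LinearMap.range g = Submodule.span L (f '' W) := by
    apply le_antisymm
    · rintro _ ⟨z, rfl⟩
      induction z with
      | zero => simp
      | add x y hx hy => rw [map_add]; exact add_mem hx hy
      | tmul s w =>
        simp only [g, LinearMap.comp_apply, LinearMap.baseChange_tmul, LinearEquiv.coe_coe,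
          hf.equiv_tmul]
        exact Submodule.smul_mem _ _ (Submodule.subset_span ⟨w, w.2, rfl⟩)
    · rw [Submodule.span_le]
      rintro _ ⟨w, hw, rfl⟩
      exact ⟨1 ⊗ₜ ⟨w, hw⟩, by simp [g, hf.equiv_tmul]⟩
  rw [← hr, LinearMap.finrank_range_of_inj hg, Module.finrank_baseChange]

/-- Descent of inclusions: `W ⊔ W'` and `W'` have the same span over `L`, hence the same dimension
over `k`. -/
theorem IsBaseChange.le_of_span_image_le (hf : IsBaseChange L f) [FiniteDimensional k M]
    {W W' : Submodule k M}
    (h : Submodule.span L (f '' W) ≤ Submodule.span L (f '' W')) : W ≤ W' := by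
  have h1 : Submodule.span L (f '' (W ⊔ W' : Submodule k M)) = Submodule.span L (f '' W') := by
    apply le_antisymm
    · rw [Submodule.span_le]
      rintro _ ⟨x, hx, rfl⟩
      obtain ⟨y, hy, z, hz, rfl⟩ := Submodule.mem_sup.1 hx
      rw [map_add]
      exact add_mem (h (Submodule.subset_span ⟨y, hy, rfl⟩)) (Submodule.subset_span ⟨z, hz, rfl⟩)
    · exact Submodule.span_mono (Set.image_mono (le_sup_right : W' ≤ W ⊔ W'))
  have h2 : Module.finrank k (W ⊔ W' : Submodule k M) = Module.finrank k W' := by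
    rw [← hf.finrank_span_image, h1, hf.finrank_span_image]
  rw [Submodule.eq_of_le_of_finrank_eq (le_sup_right : W' ≤ W ⊔ W') h2.symm]
  exact le_sup_left

theorem IsBaseChange.span_range_eq_top (hf : IsBaseChange L f) : Submodule.span L (Set.range f) = ⊤ := by
  rw [eq_top_iff]
  intro x _
  induction x using hf.inductionOn with
  | zero => exact zero_mem _
  | tmul m => exact Submodule.subset_span ⟨m, rfl⟩
  | smul s n hn => exact Submodule.smul_mem _ _ (hn trivial)
  | add a b ha hb => exact add_mem (ha trivial) (hb trivial)

/-- One inclusion is immediate. Ranges visibly commute with base change, so rank-nullity makes the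
dimensions of the kernels agree. -/
theorem IsBaseChange.span_image_ker (hf : IsBaseChange L f) [FiniteDimensional k M]
    {A : Module.End k M} {A' : Module.End L N} (h : ∀ x, A' (f x) = f (A x)) :
    Submodule.span L (f '' LinearMap.ker A) = LinearMap.ker A' := by
  have hN : Module.finrank L N = Module.finrank k M := by
    rw [← hf.equiv.finrank_eq, Module.finrank_baseChange]
  have : FiniteDimensional L N := Module.Finite.equiv hf.equiv
  have hr : Submodule.span L (f '' LinearMap.range A) = LinearMap.range A' := by
    rw [LinearMap.range_eq_map A', ← hf.span_range_eq_top, Submodule.map_span]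
    congr 1
    ext y
    constructor
    · rintro ⟨_, ⟨x, rfl⟩, rfl⟩
      exact ⟨f x, ⟨x, rfl⟩, h x⟩
    · rintro ⟨_, ⟨x, rfl⟩, rfl⟩
      exact ⟨A x, ⟨x, rfl⟩, (h x).symm⟩
  apply Submodule.eq_of_le_of_finrank_eq
  · rw [Submodule.span_le]
    rintro _ ⟨x, hx, rfl⟩
    simp only [SetLike.mem_coe, LinearMap.mem_ker] at hx ⊢
    rw [h, hx, map_zero]
  · have h1 := A.finrank_range_add_finrank_ker
    have h2 := A'.finrank_range_add_finrank_ker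
    rw [← hr, hf.finrank_span_image] at h2
    rw [hf.finrank_span_image]
    omega

end BaseChange

/-! ### Pencils of decomposable vectors in an exterior power -/

section Pencil

variable {L E : Type*} [Field L] [AddCommGroup E] [Module L E]

/-- If a polynomial curve in `E` stays in a subspace at infinitely many parameters, its coefficients
lie in that subspace. -/
theorem mem_of_infinite_polynomial_mem {S : Submodule L E} {T : Set L} (hT : T.Infinite) (N : ℕ)
    (y : ℕ → E) (h : ∀ t ∈ T, ∑ i ∈ Finset.range N, t ^ i • y i ∈ S) {i : ℕ} (hi : i < N) :
    y i ∈ S := by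
  by_contra hy
  -- A functional killing `S` but not `y i` turns the curve into a scalar polynomial with infinitely
  -- many roots.
  obtain ⟨φ, hφ, hS⟩ := Submodule.exists_le_ker_of_notMem hy
  let p : Polynomial L := ∑ i ∈ Finset.range N, Polynomial.C (φ (y i)) * Polynomial.X ^ i
  have hp : p = 0 := by
    refine Polynomial.eq_zero_of_infinite_isRoot p (hT.mono fun t ht => ?_)
    have := hS (h t ht)
    simp only [LinearMap.mem_ker, map_sum, map_smul, smul_eq_mul] at this
    simp only [Set.mem_ofPred_eq, Polynomial.IsRoot, p, Polynomial.eval_finsetSum,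
      Polynomial.eval_mul, Polynomial.eval_C, Polynomial.eval_pow, Polynomial.eval_X]
    rw [← this]
    exact Finset.sum_congr rfl fun i _ => mul_comm _ _
  have := congrArg (fun q => q.coeff i) hp
  simp [p, Polynomial.coeff_C_mul, Polynomial.coeff_X_pow, hi] at this
  exact hφ this

variable {N : ℕ}

/-- The decomposable vector `⋀ᵢ (α eᵢ + β fᵢ)`. -/
def pencil (e f : Fin N → E) (α β : L) : ⋀[L]^N E :=
  exteriorPower.ιMulti L N fun i => α • e i + β • f i

/-- Multilinear expansion: `y i` collects the products that take `f` in exactly `i` slots. -/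
theorem exists_pencil_eq_sum (e f : Fin N → E) :
    ∃ y : ℕ → ⋀[L]^N E, ∀ α β : L,
      pencil e f α β = ∑ i ∈ Finset.range (N + 1), (α ^ (N - i) * β ^ i) • y i := by
  classical
  refine ⟨fun i => ∑ s ∈ Finset.univ.filter (fun s : Finset (Fin N) => sᶜ.card = i),
    exteriorPower.ιMulti L N (s.piecewise e f), fun α β => ?_⟩
  have h1 : pencil e f α β = ∑ s : Finset (Fin N), (α ^ (N - sᶜ.card) * β ^ sᶜ.card) •
      exteriorPower.ιMulti L N (s.piecewise e f) := by
    have := (exteriorPower.ιMulti L N (M := E)).map_add_univ (fun i => α • e i) (fun i => β • f i)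
    refine this.trans (Finset.sum_congr rfl fun s _ => ?_)
    have h2 : s.piecewise (fun i => α • e i) (fun i => β • f i)
        = fun i => s.piecewise (fun _ => α) (fun _ => β) i • s.piecewise e f i := by
      ext i
      by_cases hi : i ∈ s <;> simp [hi]
    rw [h2, AlternatingMap.map_smul_univ, Finset.prod_piecewise]
    congr 1
    have : N - sᶜ.card = s.card := by
      have := s.card_add_card_compl
      simp only [Fintype.card_fin] at this
      omega
    rw [this]
    simp [Finset.compl_eq_univ_sdiff]
  rw [h1, ← Finset.sum_fiberwise_of_maps_to (g := fun s : Finset (Fin N) => sᶜ.card)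
    (t := Finset.range (N + 1))]
  · refine Finset.sum_congr rfl fun i _ => ?_
    rw [Finset.smul_sum]
    refine Finset.sum_congr rfl fun s hs => ?_
    rw [(Finset.mem_filter.1 hs).2]
  · intro s _
    have := sᶜ.card_le_univ
    simp only [Fintype.card_fin] at this
    simp only [Finset.mem_range]
    omega

/-- The span of all members of the pencil spanned by `e` and `f`. -/
def pencilSpan (e f : Fin N → E) : Submodule L (⋀[L]^N E) :=
  Submodule.span L (Set.range fun u : L × L => pencil e f u.1 u.2)

theorem pencil_mem_pencilSpan (e f : Fin N → E) (α β : L) :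
    pencil e f α β ∈ pencilSpan (L := L) e f :=
  Submodule.subset_span ⟨(α, β), rfl⟩

/-- The coefficients of the pencil are recovered from any infinite set of members. This matters
because only rational parameters come from elements of `F`. -/
theorem pencilSpan_le_of_infinite (e f : Fin N → E) {T : Set L} (hT : T.Infinite)
    {S : Submodule L (⋀[L]^N E)} (h : ∀ t ∈ T, pencil e f 1 t ∈ S) : pencilSpan e f ≤ S := by
  obtain ⟨y, hy⟩ := exists_pencil_eq_sum (L := L) e f
  have hyS : ∀ i ∈ Finset.range (N + 1), y i ∈ S := fun i hi =>
    mem_of_infinite_polynomial_mem hT (N + 1) y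
      (fun t ht => by simpa [hy] using h t ht) (Finset.mem_range.1 hi)
  rw [pencilSpan, Submodule.span_le]
  rintro _ ⟨u, rfl⟩
  simp only [hy]
  exact sum_mem fun i hi => S.smul_mem _ (hyS i hi)

/-- The `N + 1` coefficients `y i` span. To see that they are independent, map `e i` to `v` times
the `i`-th unit vector and `f i` to that unit vector, and take determinants: the member with
parameters `(1, t)` goes to `(v + t) ^ N`, so `y i` goes to `N.choose i * v ^ (N - i)`, and these
binomials are nonzero in characteristic zero. -/
theorem finrank_pencilSpan [CharZero L] (b : Module.Basis (Fin N ⊕ Fin N) L E) :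
    Module.finrank L (pencilSpan (L := L) (fun i => b (.inl i)) fun i => b (.inr i)) = N + 1 := by
  set e := fun i => b (.inl i) with he
  set f := fun i => b (.inr i) with hf
  obtain ⟨y, hy⟩ := exists_pencil_eq_sum (L := L) e f
  have hT : (Set.univ : Set L).Infinite := Set.infinite_univ
  have hspan : pencilSpan e f = Submodule.span L (Set.range fun i : Fin (N + 1) => y i) := by
    apply le_antisymm
    · refine pencilSpan_le_of_infinite e f hT fun t _ => ?_
      rw [hy]
      exact sum_mem fun i hi => Submodule.smul_mem _ _
        (Submodule.subset_span ⟨⟨i, Finset.mem_range.1 hi⟩, rfl⟩)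
    · rw [Submodule.span_le]
      rintro _ ⟨i, rfl⟩
      refine mem_of_infinite_polynomial_mem hT (N + 1) y (fun t _ => ?_) i.2
      simpa [hy] using pencil_mem_pencilSpan e f 1 t
  let π (v : L) : E →ₗ[L] (Fin N → L) :=
    b.constr L (Sum.elim (fun i => v • Pi.single i 1) fun i => Pi.single i 1)
  let δ (v : L) : ⋀[L]^N E →ₗ[L] L :=
    exteriorPower.alternatingMapLinearEquiv (Matrix.detRowAlternating.compLinearMap (π v))
  have hδ : ∀ v t, δ v (pencil e f 1 t) = (v + t) ^ N := by
    intro v t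
    have h1 : (fun i => π v ((1 : L) • e i + t • f i)) = Matrix.diagonal fun _ => v + t := by
      have hπe : ∀ i, π v (e i) = v • Pi.single i 1 := fun i => b.constr_basis L _ (.inl i)
      have hπf : ∀ i, π v (f i) = Pi.single i 1 := fun i => b.constr_basis L _ (.inr i)
      ext i j
      rw [map_add, map_smul, map_smul, hπe, hπf]
      by_cases hij : i = j
      · simp [hij]
      · simp [hij, Ne.symm hij]
    simp only [δ, pencil, exteriorPower.alternatingMapLinearEquiv_apply_ιMulti,
      AlternatingMap.compLinearMap_apply]
    change Matrix.det (fun i => π v ((1 : L) • e i + t • f i)) = _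
    rw [h1, Matrix.det_diagonal]
    simp
  have hδy : ∀ v, ∀ i < N + 1, δ v (y i) = v ^ (N - i) * (N.choose i : L) := by
    intro v i hi
    have := mem_of_infinite_polynomial_mem (S := (⊥ : Submodule L L)) hT (N + 1)
      (fun i => δ v (y i) - v ^ (N - i) * (N.choose i : L)) (fun t _ => ?_) hi
    · simpa [sub_eq_zero] using this
    · have h2 := hδ v t
      rw [hy, add_comm v t, add_pow] at h2
      simp only [one_pow, one_mul, map_sum, map_smul, smul_eq_mul] at h2
      simp only [smul_eq_mul, mul_sub, Finset.sum_sub_distrib, Submodule.mem_bot, h2, sub_eq_zero]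
      exact Finset.sum_congr rfl fun i _ => by ring
  have hli : LinearIndependent L fun i : Fin (N + 1) => y i := by
    rw [Fintype.linearIndependent_iff]
    intro c hc i
    have h1 : ∀ v : L, ∑ j : Fin (N + 1), c j * (v ^ (N - (j : ℕ)) * (N.choose j : L)) = 0 := by
      intro v
      have := congrArg (δ v) hc
      simp only [map_sum, map_smul, smul_eq_mul, map_zero] at this
      rw [← this]
      exact Finset.sum_congr rfl fun j _ => by rw [hδy v j j.2]
    -- The relation is a polynomial identity in `v`; its coefficient of `v ^ m` belongs to the index
    -- `N - m`, whence the reversal below.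
    have h2 := mem_of_infinite_polynomial_mem (S := (⊥ : Submodule L L)) hT (N + 1)
      (fun m => if h : m < N + 1 then c ⟨N - m, by omega⟩ * (N.choose (N - m) : L) else 0)
      (fun v _ => ?_) (i := N - i) (by omega)
    · have h3 : N - (N - (i : ℕ)) = i := by omega
      have h4 : N - (i : ℕ) < N + 1 := by omega
      simp only [h4, dif_pos, Submodule.mem_bot, mul_eq_zero, h3, Nat.cast_eq_zero] at h2
      exact h2.resolve_right (Nat.choose_pos (by omega)).ne'
    · rw [Submodule.mem_bot, ← h1 v, Finset.sum_range, ← Equiv.sum_comp Fin.revPerm]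
      refine Finset.sum_congr rfl fun j _ => ?_
      have h3 : N - (N + 1 - ((j : ℕ) + 1)) = j := by omega
      have h4 : N + 1 - ((j : ℕ) + 1) < N + 1 := by omega
      simp only [Fin.revPerm_apply, Fin.val_rev, h3, h4, dif_pos, smul_eq_mul]
      have h5 : N - (j : ℕ) = N + 1 - (j + 1) := by omega
      rw [h5]
      ring
  rw [hspan, finrank_span_eq_card hli, Fintype.card_fin]

theorem exteriorPower.map_pencil {g : Module.End L E} {e f : Fin N → E} {α β : L}
    {v : Fin N → E} (h : ∀ i, g (v i) = α • e i + β • f i) :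
    exteriorPower.map N g (exteriorPower.ιMulti L N v) = pencil e f α β := by
  rw [exteriorPower.map_apply_ιMulti, pencil]
  congr 1
  ext i
  exact h i

end Pencil

/-! ### Quadratic subfields of quaternion algebras -/

section Quaternion

variable {F : Type*} [Ring F] [Algebra ℚ F]

/-- Generators `a`, `b` of a quaternion algebra over `ℚ` adapted to a quadratic subfield `K`. -/
structure IsQuaternionPair (K : Subalgebra ℚ F) (a b : F) (d : ℚ) : Prop where
  ne_zero : d ≠ 0
  mem : a ∈ K
  sq : a * a = algebraMap ℚ F d
  anticomm : b * a = -(a * b)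
  isUnit : IsUnit b
  exists_of_mem : ∀ x ∈ K, ∃ p q : ℚ, x = p • 1 + q • a
  exists_eq : ∀ x : F, ∃ p q r t : ℚ, x = p • 1 + q • a + b * (r • 1 + t • a)
  linearIndependent : ∀ p q : ℚ, p • (1 : F) + q • a = 0 → p = 0 ∧ q = 0

/-- Completing the square in `K` gives `a`. Since `a` is not central, some commutator `y * a - a *
y` is nonzero; it anticommutes with `a` because `a²` is central. Then `1, a, b, b * a` are
independent, hence a basis in dimension four. -/
theorem exists_isQuaternionPair (hF : IsDefiniteQuaternionAlgebra F) {K : Subalgebra ℚ F}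
    (hK : IsQuadraticSubfield K) : ∃ (a b : F) (d : ℚ), IsQuaternionPair K a b d := by
  have hFfin : FiniteDimensional ℚ F := Module.finite_of_finrank_pos (by rw [hF.finrank_eq]; simp)
  have hnt : Nontrivial F := Module.nontrivial_of_finrank_pos (R := ℚ) (by rw [hF.finrank_eq]; simp)
  have hmul : ∀ x y : F, x * y = 0 → x = 0 ∨ y = 0 := by
    intro x y hxy
    by_cases hx : x = 0
    · exact .inl hx
    · right
      obtain ⟨u, rfl⟩ := hF.isUnit_of_ne_zero x hx
      simpa using hxy
  obtain ⟨a₀, ha₀K, ha₀⟩ : ∃ a ∈ K, a ∉ Submodule.span ℚ {(1 : F)} := by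
    by_contra! h
    have h1 : Subalgebra.toSubmodule K ≤ Submodule.span ℚ {(1 : F)} := h
    have h2 := Submodule.finrank_mono h1
    rw [Subalgebra.finrank_toSubmodule, hK.finrank_eq, finrank_span_singleton one_ne_zero] at h2
    omega
  have hspan : ∀ a ∈ K, a ∉ Submodule.span ℚ {(1 : F)} →
      (∀ p q : ℚ, p • (1 : F) + q • a = 0 → p = 0 ∧ q = 0) ∧
      ∀ x ∈ K, ∃ p q : ℚ, x = p • 1 + q • a := by
    intro a haK ha
    have hq : ∀ p q : ℚ, p • (1 : F) + q • a = 0 → p = 0 ∧ q = 0 := by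
      intro p q h
      have hq : q = 0 := by
        by_contra hq
        apply ha
        rw [Submodule.mem_span_singleton]
        refine ⟨-(q⁻¹ * p), ?_⟩
        have : q⁻¹ • (p • (1 : F) + q • a) = 0 := by rw [h, smul_zero]
        rw [smul_add, smul_smul, smul_smul, inv_mul_cancel₀ hq, one_smul] at this
        rw [neg_smul]
        exact neg_eq_of_add_eq_zero_right this
      subst hq
      simpa using h
    refine ⟨hq, fun x hx => ?_⟩
    have hli : LinearIndependent ℚ ![(1 : F), a] := LinearIndependent.pair_iff.2 hq
    have h1 : Submodule.span ℚ (Set.range ![(1 : F), a]) = Subalgebra.toSubmodule K := by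
      apply Submodule.eq_of_le_of_finrank_eq
      · rw [Submodule.span_le]
        rintro _ ⟨i, rfl⟩
        fin_cases i
        · exact K.one_mem
        · exact haK
      · rw [finrank_span_eq_card hli, Subalgebra.finrank_toSubmodule, hK.finrank_eq]
        simp
    have h2 : x ∈ Submodule.span ℚ (Set.range ![(1 : F), a]) := by rw [h1]; exact hx
    rw [Matrix.range_cons, Matrix.range_cons, Matrix.range_empty, Set.union_empty,
      Set.singleton_union, Submodule.mem_span_pair] at h2
    obtain ⟨p, q, h⟩ := h2
    exact ⟨p, q, h.symm⟩
  obtain ⟨p₀, q₀, h₀⟩ := (hspan a₀ ha₀K ha₀).2 (a₀ * a₀) (K.mul_mem ha₀K ha₀K)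
  set a : F := a₀ - (q₀ / 2) • (1 : F) with ha_def
  have haK : a ∈ K := K.sub_mem ha₀K (K.smul_mem K.one_mem _)
  have ha : a ∉ Submodule.span ℚ {(1 : F)} := by
    intro h
    apply ha₀
    have := add_mem h (Submodule.smul_mem _ (q₀ / 2) (Submodule.mem_span_singleton_self (1 : F)))
    simpa [ha_def] using this
  obtain ⟨hli, hKspan⟩ := hspan a haK ha
  have hsq : a * a = algebraMap ℚ F (p₀ + q₀ ^ 2 / 4) := by
    rw [Algebra.algebraMap_eq_smul_one, ha_def]
    simp only [sub_mul, mul_sub, h₀, smul_mul_assoc, mul_smul_comm, one_mul, mul_one]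
    module
  clear_value a
  have ha0 : a ≠ 0 := fun h => ha (h ▸ zero_mem _)
  have hd : p₀ + q₀ ^ 2 / 4 ≠ 0 := by
    intro h
    rw [h, map_zero] at hsq
    rcases hmul a a hsq with h | h <;> exact ha0 h
  obtain ⟨y, hy⟩ : ∃ y : F, y * a ≠ a * y := by
    by_contra! h
    have h1 : a ∈ Subalgebra.center ℚ F := Subalgebra.mem_center_iff.2 h
    rw [hF.isCentral.center_eq_bot, Algebra.mem_bot] at h1
    obtain ⟨c, hc⟩ := h1
    exact ha (Submodule.mem_span_singleton.2 ⟨c, by rw [← hc, Algebra.algebraMap_eq_smul_one]⟩)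
  set b : F := y * a - a * y with hb_def
  have hb0 : b ≠ 0 := sub_ne_zero.2 hy
  have hba : b * a = -(a * b) := by
    have h1 : y * a * a = a * (a * y) := by
      rw [mul_assoc, hsq, ← mul_assoc, hsq, Algebra.commutes]
    rw [hb_def, sub_mul, mul_sub, h1]
    noncomm_ring
  clear_value b
  -- Moving `a` across `k + b * l` changes it to `k - b * l`, so both vanish, and with them `k` and
  -- `l`.
  have hind : ∀ p q r t : ℚ, p • (1 : F) + q • a + b * (r • 1 + t • a) = 0 →
      (p = 0 ∧ q = 0) ∧ (r = 0 ∧ t = 0) := by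
    intro p q r t h
    have hcl : a * (r • 1 + t • a) = (r • 1 + t • a) * a := by
      simp [mul_add, add_mul]
    have hck : a * (p • 1 + q • a) = (p • 1 + q • a) * a := by
      simp [mul_add, add_mul]
    set k := p • (1 : F) + q • a
    set l := r • (1 : F) + t • a
    have h1 : a * (k + b * l) = 0 := by rw [h, mul_zero]
    have h2 : (k + b * l) * a = 0 := by rw [h, zero_mul]
    have h3 : (k + b * l) * a = a * (k - b * l) := by
      rw [add_mul, mul_sub, hck, mul_assoc, ← hcl, ← mul_assoc, hba, ← mul_assoc]
      noncomm_ring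
    rw [h3] at h2
    have h4 := (hmul _ _ h2).resolve_left ha0
    have h5 : (2 : ℚ) • k = 0 := by
      calc (2 : ℚ) • k = (k + b * l) + (k - b * l) := by module
        _ = 0 := by rw [h, h4, add_zero]
    have hk : k = 0 := (smul_eq_zero.1 h5).resolve_left two_ne_zero
    rw [hk, zero_add] at h
    exact ⟨hli p q hk, hli r t ((hmul _ _ h).resolve_left hb0)⟩
  refine ⟨a, b, _, hd, haK, hsq, hba, hF.isUnit_of_ne_zero b hb0, hKspan, fun x => ?_, hli⟩
  let φ : (Fin 4 → ℚ) →ₗ[ℚ] F := Fintype.linearCombination ℚ ![1, a, b, b * a]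
  have hφ : ∀ c, φ c = c 0 • (1 : F) + c 1 • a + b * (c 2 • 1 + c 3 • a) := by
    intro c
    simp [φ, Fintype.linearCombination_apply, Fin.sum_univ_four, mul_add, add_assoc]
  have hinj : Function.Injective φ := by
    rw [injective_iff_map_eq_zero]
    intro c hc
    rw [hφ] at hc
    obtain ⟨⟨h0, h1⟩, h2, h3⟩ := hind _ _ _ _ hc
    ext i
    fin_cases i <;> assumption
  have hsurj : Function.Surjective φ :=
    (LinearMap.injective_iff_surjective_of_finrank_eq_finrank (by simp [hF.finrank_eq])).1 hinj
  obtain ⟨c, rfl⟩ := hsurj x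
  exact ⟨_, _, _, _, hφ c⟩

/-- In the basis `1, a` the matrix of multiplication by `y` is `!![p, q * d; q, p]`. -/
theorem IsQuaternionPair.trace_det_mulLeft {K : Subalgebra ℚ F} {a b : F} {d : ℚ}
    (h : IsQuaternionPair K a b d) (y : K) {p q : ℚ} (hy : (y : F) = p • 1 + q • a) :
    LinearMap.trace ℚ K (LinearMap.mulLeft ℚ y) = 2 * p ∧
      LinearMap.det (LinearMap.mulLeft ℚ y) = p ^ 2 - q ^ 2 * d := by
  let v : Fin 2 → K := ![1, ⟨a, h.mem⟩]
  have hv : LinearIndependent ℚ v := by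
    refine LinearIndependent.pair_iff.2 fun s t hst => h.linearIndependent s t ?_
    simpa using congrArg (Subtype.val : K → F) hst
  have hspan : ⊤ ≤ Submodule.span ℚ (Set.range v) := by
    rintro ⟨x, hx⟩ -
    obtain ⟨p, q, rfl⟩ := h.exists_of_mem x hx
    rw [Matrix.range_cons, Matrix.range_cons, Matrix.range_empty, Set.union_empty,
      Set.singleton_union, Submodule.mem_span_pair]
    exact ⟨p, q, Subtype.ext (by simp)⟩
  let B := Module.Basis.mk hv hspan
  have hB0 : B 0 = 1 := by simp [B, v]
  have hB1 : B 1 = ⟨a, h.mem⟩ := by simp [B, v]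
  have h0 : LinearMap.mulLeft ℚ y (B 0) = p • B 0 + q • B 1 := by
    rw [hB0, hB1]
    exact Subtype.ext (by simp [hy])
  have h1 : LinearMap.mulLeft ℚ y (B 1) = (q * d) • B 0 + p • B 1 := by
    rw [hB0, hB1]
    refine Subtype.ext ?_
    simp only [LinearMap.mulLeft_apply, MulMemClass.coe_mul, hy, add_mul, smul_mul_assoc, one_mul,
      h.sq, Algebra.algebraMap_eq_smul_one]
    simp [smul_smul, add_comm]
  have hM : LinearMap.toMatrix B B (LinearMap.mulLeft ℚ y) = !![p, q * d; q, p] := by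
    ext i j
    rw [LinearMap.toMatrix_apply]
    fin_cases j
    · simp only [Fin.zero_eta, h0]
      fin_cases i <;> simp
    · simp only [Fin.mk_one, h1]
      fin_cases i <;> simp
  constructor
  · rw [LinearMap.trace_eq_matrix_trace ℚ B, hM, Matrix.trace_fin_two]
    simp
    ring
  · rw [← LinearMap.det_toMatrix B, hM, Matrix.det_fin_two]
    simp
    ring

end Quaternion

/-! ### Extremal eigenvectors in an exterior power -/

section Eigen

variable {L E : Type*} [Field L] [AddCommGroup E] [Module L E] {N : ℕ}

theorem ιMulti_mem_span_of_injective (e : Fin N → E) {σ : Fin N → Fin N}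
    (hσ : Function.Injective σ) :
    exteriorPower.ιMulti L N (fun i => e (σ i)) ∈
      Submodule.span L {exteriorPower.ιMulti L N e} := by
  let τ : Equiv.Perm (Fin N) := Equiv.ofBijective σ (Finite.injective_iff_bijective.1 hσ)
  have := (exteriorPower.ιMulti L N (M := E)).map_perm e τ
  change exteriorPower.ιMulti L N (e ∘ τ) ∈ _
  rw [this, Units.smul_def, ← Int.cast_smul_eq_zsmul L]
  exact Submodule.smul_mem _ _ (Submodule.mem_span_singleton_self _)

/-- If `g` has eigenvalue `μ` on the first half and `ν` on the second half of a basis, and no mixed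
product of `N` eigenvalues equals `μ ^ N` or `ν ^ N`, then the eigenspaces of `⋀^N g` for `μ ^ N` and
`ν ^ N` are spanned by the two extremal vectors. -/
theorem ker_map_eigen_le {g : Module.End L E} (B : Module.Basis (Fin N ⊕ Fin N) L E) {μ ν : L}
    (hμ : μ ≠ 0) (hν : ν ≠ 0) (hμν : ∀ m, 1 ≤ m → m ≤ N → μ ^ m ≠ ν ^ m)
    (he : ∀ i, g (B (.inl i)) = μ • B (.inl i)) (hf : ∀ i, g (B (.inr i)) = ν • B (.inr i)) :
    LinearMap.ker (exteriorPower.map N g ^ 2 - (μ ^ N + ν ^ N) • exteriorPower.map N g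
      + (μ ^ N * ν ^ N) • (1 : Module.End L (⋀[L]^N E))) ≤
      Submodule.span L {exteriorPower.ιMulti L N fun i => B (.inl i),
        exteriorPower.ιMulti L N fun i => B (.inr i)} := by
  -- The lexicographic sum supplies the linear order on indices that the basis of the exterior power
  -- requires.
  let B' : Module.Basis (Fin N ⊕ₗ Fin N) L E := B.reindex toLex
  let BE := B'.exteriorPower N
  let c : Fin N ⊕ₗ Fin N → L := fun i => Sum.elim (fun _ => μ) (fun _ => ν) (ofLex i)
  have hB' : ∀ i, B' i = B (ofLex i) := fun i => by simp [B']
  have hg : ∀ i, g (B' i) = c i • B' i := by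
    intro i
    rw [hB']
    rcases h : ofLex i with j | j
    · simp only [c, h, he, Sum.elim_inl]
    · simp only [c, h, hf, Sum.elim_inr]
  let v (s : Set.powersetCard (Fin N ⊕ₗ Fin N) N) : Fin N → Fin N ⊕ₗ Fin N :=
    fun i => Set.powersetCard.ofFinEmbEquiv.symm s i
  have hvinj : ∀ s, Function.Injective (v s) := fun s =>
    (Set.powersetCard.ofFinEmbEquiv.symm s).injective
  have hBE : ∀ s, BE s = exteriorPower.ιMulti L N fun i => B' (v s i) := by
    intro s
    simp only [BE, exteriorPower.basis_apply, exteriorPower.ιMulti_family]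
    rfl
  have heig : ∀ s, exteriorPower.map N g (BE s) = (∏ i, c (v s i)) • BE s := by
    intro s
    rw [hBE, exteriorPower.map_apply_ιMulti, ← AlternatingMap.map_smul_univ]
    congr 1
    ext i
    exact hg _
  set P : Module.End L (⋀[L]^N E) := exteriorPower.map N g ^ 2
    - (μ ^ N + ν ^ N) • exteriorPower.map N g + (μ ^ N * ν ^ N) • 1 with hP
  have hPs : ∀ s, P (BE s) =
      ((∏ i, c (v s i) - μ ^ N) * (∏ i, c (v s i) - ν ^ N)) • BE s := by
    intro s
    simp only [hP, LinearMap.add_apply, LinearMap.sub_apply, LinearMap.smul_apply, pow_two,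
      Module.End.mul_apply, heig, map_smul, Module.End.one_apply]
    module
  intro w hw
  rw [LinearMap.mem_ker] at hw
  rw [← BE.sum_repr w]
  refine sum_mem fun s _ => ?_
  -- `P` is diagonal in this basis, so a vector of its kernel has nonzero coordinates only where the
  -- eigenvalue of `P` vanishes.
  have hcoord : (∏ i, c (v s i) - μ ^ N) * (∏ i, c (v s i) - ν ^ N) * BE.repr w s = 0 := by
    have h1 : BE.coord s ∘ₗ P =
        ((∏ i, c (v s i) - μ ^ N) * (∏ i, c (v s i) - ν ^ N)) • BE.coord s := by
      refine BE.ext fun t => ?_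
      simp only [LinearMap.comp_apply, hPs, map_smul, LinearMap.smul_apply, Module.Basis.coord_apply,
        Module.Basis.repr_self]
      by_cases hst : t = s
      · rw [hst]
      · simp [hst]
    have h2 := LinearMap.congr_fun h1 w
    simp only [LinearMap.comp_apply, hw, map_zero, LinearMap.smul_apply, smul_eq_mul,
      Module.Basis.coord_apply] at h2
    exact h2.symm
  rcases mul_eq_zero.1 hcoord with hs | hs
  swap
  · rw [hs, zero_smul]
    exact zero_mem _
  refine Submodule.smul_mem _ _ ?_
  by_cases hl : ∀ i, ∃ j, v s i = toLex (.inl j)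
  · choose σ hσ using hl
    have hσi : Function.Injective σ := fun i j hij => hvinj s (by rw [hσ, hσ, hij])
    refine Submodule.span_mono (Set.singleton_subset_iff.2 (by simp))
      (?_ : BE s ∈ Submodule.span L {exteriorPower.ιMulti L N fun i => B (.inl i)})
    have := ιMulti_mem_span_of_injective (L := L) (fun i => B (.inl i)) hσi
    rw [hBE]
    simpa only [hσ, hB', ofLex_toLex] using this
  by_cases hr : ∀ i, ∃ j, v s i = toLex (.inr j)
  · choose σ hσ using hr
    have hσi : Function.Injective σ := fun i j hij => hvinj s (by rw [hσ, hσ, hij])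
    refine Submodule.span_mono (Set.singleton_subset_iff.2 (by simp))
      (?_ : BE s ∈ Submodule.span L {exteriorPower.ιMulti L N fun i => B (.inr i)})
    have := ιMulti_mem_span_of_injective (L := L) (fun i => B (.inr i)) hσi
    rw [hBE]
    simpa only [hσ, hB', ofLex_toLex] using this
  exfalso
  classical
  push Not at hl hr
  obtain ⟨i₁, hi₁⟩ := hl
  obtain ⟨i₂, hi₂⟩ := hr
  let S := Finset.univ.filter fun i => (ofLex (v s i)).isLeft
  have hprod : ∏ i, c (v s i) = μ ^ S.card * ν ^ Sᶜ.card := by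
    rw [← Finset.prod_mul_prod_compl S, ← Finset.prod_const, ← Finset.prod_const]
    congr 1
    · refine Finset.prod_congr rfl fun i hi => ?_
      obtain ⟨j, hj⟩ := Sum.isLeft_iff.1 (Finset.mem_filter.1 hi).2
      simp only [c, hj, Sum.elim_inl]
    · refine Finset.prod_congr rfl fun i hi => ?_
      have : ¬ (ofLex (v s i)).isLeft := by simpa [S] using hi
      obtain ⟨j, hj⟩ := Sum.isRight_iff.1 (Sum.not_isLeft.1 this)
      simp only [c, hj, Sum.elim_inr]
  have hcard : S.card + Sᶜ.card = N := by simp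
  have hS : 1 ≤ S.card := by
    refine Finset.card_pos.2 ⟨i₂, ?_⟩
    simp only [S, Finset.mem_filter, Finset.mem_univ, true_and]
    rcases h : ofLex (v s i₂) with j | j
    · rfl
    · exact absurd (congrArg toLex h) (hi₂ j)
  have hSc : 1 ≤ Sᶜ.card := by
    refine Finset.card_pos.2 ⟨i₁, ?_⟩
    simp only [S, Finset.mem_compl, Finset.mem_filter, Finset.mem_univ, true_and]
    rcases h : ofLex (v s i₁) with j | j
    · exact absurd (congrArg toLex h) (hi₁ j)
    · simp
  rw [hprod] at hs
  have hN1 : μ ^ N = μ ^ S.card * μ ^ Sᶜ.card := by rw [← pow_add, hcard]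
  have hN2 : ν ^ N = ν ^ S.card * ν ^ Sᶜ.card := by rw [← pow_add, hcard]
  -- In a mixed product both exponents are positive; cancelling common powers leaves `μ ^ m = ν ^ m`
  -- with `1 ≤ m ≤ N`.
  rw [hN1, hN2, ← mul_sub, ← sub_mul] at hs
  rcases mul_eq_zero.1 hs with hs | hs <;> rcases mul_eq_zero.1 hs with hs | hs
  · exact pow_ne_zero _ hμ hs
  · exact hμν _ hSc (by omega) (sub_eq_zero.1 hs).symm
  · exact hμν _ hS (by omega) (sub_eq_zero.1 hs)
  · exact pow_ne_zero _ hν hs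

/-- For all but finitely many rational `t`, the quotient `(t + s) / (t - s)` is not a root of unity of
order at most `N`. -/
theorem exists_rat_pow_ne [CharZero L] {s : L} (hs : s ≠ 0) (N : ℕ) :
    ∃ t : ℚ, (t : L) + s ≠ 0 ∧ (t : L) - s ≠ 0 ∧
      ∀ m, 1 ≤ m → m ≤ N → ((t : L) + s) ^ m ≠ ((t : L) - s) ^ m := by
  open Polynomial in
  let p : L[X] := (X + C s) * (X - C s) *
    ∏ m ∈ Finset.Icc 1 N, ((X + C s) ^ m - (X - C s) ^ m)
  have hp : p ≠ 0 := by
    refine mul_ne_zero (mul_ne_zero (X_add_C_ne_zero s) (X_sub_C_ne_zero s))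
      (Finset.prod_ne_zero_iff.2 fun m hm h => ?_)
    -- At `X = s` this factor is `(2 * s) ^ m`, which is nonzero.
    have h1 := congrArg (eval s) h
    have h2 : m ≠ 0 := by have := (Finset.mem_Icc.1 hm).1; omega
    simp only [eval_sub, eval_pow, eval_add, eval_X, eval_C, sub_self, zero_pow h2, sub_zero,
      eval_zero] at h1
    refine hs ?_
    have h3 := pow_eq_zero_iff h2 |>.1 h1
    rw [← two_mul] at h3
    exact (mul_eq_zero.1 h3).resolve_left two_ne_zero
  have hinf : (Set.range ((↑) : ℚ → L)).Infinite := Set.infinite_range_of_injective Rat.cast_injective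
  obtain ⟨_, ⟨t, rfl⟩, ht⟩ : ∃ x ∈ Set.range ((↑) : ℚ → L), ¬ p.IsRoot x := by
    by_contra! h
    exact hp (Polynomial.eq_zero_of_infinite_isRoot p (hinf.mono h))
  have ht' : p.eval (t : L) ≠ 0 := ht
  simp only [p, eval_mul, eval_add, eval_sub, eval_X, eval_C, eval_prod, eval_pow] at ht'
  refine ⟨t, fun h => ht' (by rw [h]; simp), fun h => ht' (by rw [h]; simp), fun m h1 h2 h => ht' ?_⟩
  rw [Finset.prod_eq_zero (Finset.mem_Icc.2 ⟨h1, h2⟩) (sub_eq_zero.2 h), mul_zero]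

end Eigen

/-! ### Adapted bases for right actions of a quaternion algebra -/

section Swap

variable {L E : Type*} [Field L] [CharZero L] [AddCommGroup E] [Module L E] [FiniteDimensional L E]

/-- If `B` is injective and anticommutes with `A`, where `A ^ 2 = s ^ 2 ≠ 0`, then the two eigenspaces
of `A` on a stable subspace have the same dimension. -/
theorem two_mul_finrank_inf_ker {A B : Module.End L E} {s : L} (hs : s ≠ 0)
    (hA : ∀ v, A (A v) = (s * s) • v) (hAB : ∀ v, A (B v) = -B (A v))
    (hB : Function.Injective B) {P : Submodule L E} (hPA : ∀ v ∈ P, A v ∈ P)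
    (hPB : ∀ v ∈ P, B v ∈ P) :
    2 * Module.finrank L (P ⊓ LinearMap.ker (A - s • 1) : Submodule L E) = Module.finrank L P := by
  have key : ∀ r : L, ∀ v, v ∈ P ⊓ LinearMap.ker (A - r • 1) ↔ v ∈ P ∧ A v = r • v := by
    intro r v
    simp [Submodule.mem_inf, LinearMap.mem_ker, sub_eq_zero]
  have hle : ∀ r : L, Module.finrank L (P ⊓ LinearMap.ker (A - r • 1) : Submodule L E) ≤
      Module.finrank L (P ⊓ LinearMap.ker (A - (-r) • 1) : Submodule L E) := by
    intro r
    rw [(Submodule.equivMapOfInjective B hB _).finrank_eq]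
    apply Submodule.finrank_mono
    rintro _ ⟨v, hv, rfl⟩
    obtain ⟨hvP, hv⟩ := (key r v).1 hv
    exact (key _ _).2 ⟨hPB v hvP, by rw [hAB, hv, map_smul, neg_smul]⟩
  have h1 := hle s
  have h2 := hle (-s)
  rw [neg_neg] at h2
  have hsup : (P ⊓ LinearMap.ker (A - s • 1)) ⊔ (P ⊓ LinearMap.ker (A - (-s) • 1)) = P := by
    apply le_antisymm (sup_le inf_le_left inf_le_left)
    intro v hv
    -- The operators `(s ± A) / (2 * s)` are the projections onto the two eigenspaces.
    have hv1 : (2 * s)⁻¹ • (s • v + A v) ∈ P ⊓ LinearMap.ker (A - s • 1) :=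
      (key _ _).2 ⟨P.smul_mem _ (P.add_mem (P.smul_mem _ hv) (hPA v hv)), by
        simp only [map_smul, map_add, hA]
        module⟩
    have hv2 : (2 * s)⁻¹ • (s • v - A v) ∈ P ⊓ LinearMap.ker (A - (-s) • 1) :=
      (key _ _).2 ⟨P.smul_mem _ (P.sub_mem (P.smul_mem _ hv) (hPA v hv)), by
        simp only [map_smul, map_sub, hA]
        module⟩
    have hv3 : v = (2 * s)⁻¹ • (s • v + A v) + (2 * s)⁻¹ • (s • v - A v) := by
      rw [← smul_add]
      have : s • v + A v + (s • v - A v) = (2 * s) • v := by module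
      rw [this, smul_smul, inv_mul_cancel₀ (mul_ne_zero two_ne_zero hs), one_smul]
    rw [hv3]
    exact Submodule.add_mem_sup hv1 hv2
  have hinf : (P ⊓ LinearMap.ker (A - s • 1)) ⊓ (P ⊓ LinearMap.ker (A - (-s) • 1)) = ⊥ := by
    rw [eq_bot_iff]
    rintro v ⟨hv1, hv2⟩
    have h1 := ((key _ _).1 hv1).2
    rw [((key _ _).1 hv2).2] at h1
    have h3 : (2 * s) • v = 0 := by
      calc (2 * s) • v = s • v - (-s) • v := by module
        _ = 0 := by rw [h1, sub_self]
    exact (smul_eq_zero.1 h3).resolve_left (mul_ne_zero two_ne_zero hs)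
  have := Submodule.finrank_sup_add_finrank_inf_eq (P ⊓ LinearMap.ker (A - s • 1))
    (P ⊓ LinearMap.ker (A - (-s) • 1))
  rw [hsup, hinf, finrank_bot] at this
  omega

theorem exists_linearIndependent_mem {S : Submodule L E} {n : ℕ} (hS : Module.finrank L S = n) :
    ∃ v : Fin n → E, LinearIndependent L v ∧ ∀ i, v i ∈ S :=
  let b := Module.finBasisOfFinrankEq L S hS
  ⟨fun i => b i, b.linearIndependent.map' S.subtype S.ker_subtype, fun i => (b i).2⟩

/-- Each of `P` and `Q` contributes half of its dimension to the `s`-eigenspace. The vectors from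
`P` are listed first, as in the generators of `hodgePiece`. -/
theorem exists_eigenvectors_of_disjoint {A B : Module.End L E} {s : L} (hs : s ≠ 0)
    (hA : ∀ v, A (A v) = (s * s) • v) (hAB : ∀ v, A (B v) = -B (A v))
    (hB : Function.Injective B) {P Q : Submodule L E} (hPQ : Disjoint P Q)
    (hPA : ∀ v ∈ P, A v ∈ P) (hPB : ∀ v ∈ P, B v ∈ P)
    (hQA : ∀ v ∈ Q, A v ∈ Q) (hQB : ∀ v ∈ Q, B v ∈ Q) {n : ℕ}
    (hP : Module.finrank L P = 2 * n) (hQ : Module.finrank L Q = 2 * n) :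
    ∃ e : Fin (2 * n) → E, LinearIndependent L e ∧ (∀ i, A (e i) = s • e i) ∧
      (∀ i : Fin (2 * n), (i : ℕ) < n → e i ∈ P) ∧ (∀ i : Fin (2 * n), n ≤ (i : ℕ) → e i ∈ Q) := by
  have h1 := two_mul_finrank_inf_ker hs hA hAB hB hPA hPB
  have h2 := two_mul_finrank_inf_ker hs hA hAB hB hQA hQB
  obtain ⟨bP, hbP, hbP'⟩ := exists_linearIndependent_mem
    (S := P ⊓ LinearMap.ker (A - s • 1)) (n := n) (by omega)
  obtain ⟨bQ, hbQ, hbQ'⟩ := exists_linearIndependent_mem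
    (S := Q ⊓ LinearMap.ker (A - s • 1)) (n := n) (by omega)
  let φ : Fin (2 * n) ≃ Fin n ⊕ Fin n := (finCongr (two_mul n)).trans finSumFinEquiv.symm
  let e₀ : Fin n ⊕ Fin n → E := Sum.elim bP bQ
  have hli : LinearIndependent L e₀ := by
    refine LinearIndependent.sum_type hbP hbQ ?_
    refine hPQ.mono ?_ ?_ <;> rw [Submodule.span_le] <;> rintro _ ⟨i, rfl⟩
    · exact (hbP' i).1
    · exact (hbQ' i).1
  have hφl : ∀ (i : Fin (2 * n)) (h : (i : ℕ) < n), φ i = .inl ⟨i, h⟩ := by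
    intro i h
    rw [← Equiv.eq_symm_apply]
    ext
    simp [φ]
  have hφr : ∀ (i : Fin (2 * n)) (h : n ≤ (i : ℕ)), φ i = .inr ⟨i - n, by omega⟩ := by
    intro i h
    rw [← Equiv.eq_symm_apply]
    ext
    simp [φ]
    omega
  refine ⟨e₀ ∘ φ, hli.comp φ φ.injective, fun i => ?_, fun i hi => ?_, fun i hi => ?_⟩
  · rw [Function.comp_apply]
    have hker : ∀ x ∈ LinearMap.ker (A - s • 1), A x = s • x := fun x hx => by
      simpa [LinearMap.mem_ker, sub_eq_zero] using hx
    rcases φ i with j | j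
    · exact hker _ (hbP' j).2
    · exact hker _ (hbQ' j).2
  · rw [Function.comp_apply, hφl i hi]
    exact (hbP' _).1
  · rw [Function.comp_apply, hφr i hi]
    exact (hbQ' _).1

end Swap

/-! ### Right actions of a quaternion algebra on a vector space -/

section RightAction

variable {F : Type*} [Ring F] [Algebra ℚ F] {L E : Type*} [Field L] [CharZero L] [AddCommGroup E]
  [Module L E] [Module ℚ E] [SMulCommClass L ℚ E]

/-- A linear right action of the algebra `F` on a vector space. -/
structure IsRightAction (T : F →ₗ[ℚ] Module.End L E) : Prop where
  map_one : T 1 = 1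
  map_mul : ∀ x y, T (x * y) = T y * T x

variable {T : F →ₗ[ℚ] Module.End L E} {K : Subalgebra ℚ F} {a b : F} {d : ℚ} {s : L}

theorem IsRightAction.injective (hT : IsRightAction T) {x : F} (hx : IsUnit x) : Function.Injective (T x) := by
  obtain ⟨u, rfl⟩ := hx
  refine Function.LeftInverse.injective (g := T (↑u⁻¹ : F)) fun v => ?_
  rw [← Module.End.mul_apply, ← hT.map_mul, Units.mul_inv, hT.map_one, Module.End.one_apply]

theorem IsRightAction.apply_apply (hT : IsRightAction T)
    (h : IsQuaternionPair K a b d) (hs : s * s = (d : L)) (v : E) : T a (T a v) = (s * s) • v := by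
  rw [← Module.End.mul_apply, ← hT.map_mul, h.sq, Algebra.algebraMap_eq_smul_one, map_smul,
    hT.map_one, hs]
  simp [← Rat.cast_smul_eq_qsmul L]

theorem IsRightAction.apply_anticomm (hT : IsRightAction T)
    (h : IsQuaternionPair K a b d) (v : E) : T a (T b v) = -T b (T a v) := by
  rw [← Module.End.mul_apply, ← hT.map_mul, h.anticomm, map_neg, hT.map_mul]
  rfl

variable {N : ℕ}

/-- The basis `(eᵢ, b eᵢ)` obtained from independent eigenvectors `eᵢ` of `a`. -/
theorem IsRightAction.exists_basis (hT : IsRightAction T)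
    (h : IsQuaternionPair K a b d) [FiniteDimensional L E] (hs0 : s ≠ 0) (hE : Module.finrank L E = N + N)
    {e : Fin N → E} (he : LinearIndependent L e) (hae : ∀ i, T a (e i) = s • e i) :
    ∃ B : Module.Basis (Fin N ⊕ Fin N) L E,
      (∀ i, B (.inl i) = e i) ∧ ∀ i, B (.inr i) = T b (e i) := by
  have hli : LinearIndependent L (Sum.elim e fun i => T b (e i)) := by
    refine LinearIndependent.sum_type he
      (he.map' (T b) (LinearMap.ker_eq_bot.2 (hT.injective h.isUnit))) ?_
    rw [Submodule.disjoint_def]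
    intro v hv1 hv2
    have h1 : T a v = s • v := by
      have : Submodule.span L (Set.range e) ≤ LinearMap.eqLocus (T a) (s • 1) := by
        rw [Submodule.span_le]
        rintro _ ⟨i, rfl⟩
        simp [hae]
      simpa using this hv1
    have h2 : T a v = (-s) • v := by
      have : Submodule.span L (Set.range fun i => T b (e i)) ≤
          LinearMap.eqLocus (T a) ((-s) • 1) := by
        rw [Submodule.span_le]
        rintro _ ⟨i, rfl⟩
        simp [hT.apply_anticomm h, hae]
      simpa using this hv2
    have h3 : (2 * s) • v = 0 := by
      calc (2 * s) • v = s • v - (-s) • v := by module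
        _ = 0 := by rw [← h1, ← h2, sub_self]
    exact (smul_eq_zero.1 h3).resolve_left (mul_ne_zero two_ne_zero hs0)
  have hspan : Submodule.span L (Set.range (Sum.elim e fun i => T b (e i))) = ⊤ :=
    hli.span_eq_top_of_card_eq_finrank' (by simp [hE])
  exact ⟨.mk hli hspan.ge, fun i => by simp, fun i => by simp⟩

/-- With respect to the basis `(eᵢ, b eᵢ)`, the action of `F` is through `2 × 2` matrices that do not
depend on `i`. -/
theorem IsRightAction.exists_coeff (hT : IsRightAction T)
    (h : IsQuaternionPair K a b d) {e : Fin N → E} (hae : ∀ i, T a (e i) = s • e i) (x : F) :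
    ∃ α β : L, ∀ i, T x (e i) = α • e i + β • T b (e i) := by
  obtain ⟨p, q, r, t, rfl⟩ := h.exists_eq x
  -- The sign in `r - t * s` arises because `a` acts on `T b (e i)` by `-s`.
  refine ⟨p + q * s, r - t * s, fun i => ?_⟩
  simp only [map_add, map_smul, hT.map_mul, hT.map_one, LinearMap.add_apply, LinearMap.smul_apply,
    Module.End.one_apply, Module.End.mul_apply, hae, hT.apply_anticomm h]
  simp only [← Rat.cast_smul_eq_qsmul L]
  module

theorem IsRightAction.exists_coeff' (hT : IsRightAction T)
    (h : IsQuaternionPair K a b d) {e : Fin N → E} (hae : ∀ i, T a (e i) = s • e i) (x : F) :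
    ∃ α β : L, ∀ i, T x (T b (e i)) = α • e i + β • T b (e i) := by
  obtain ⟨α, β, hαβ⟩ := hT.exists_coeff h hae (b * x)
  exact ⟨α, β, fun i => by rw [← hαβ, hT.map_mul, Module.End.mul_apply]⟩

end RightAction

/-! ### Cohomology of a complex torus with rational and complex coefficients -/

section TorusCohomology

variable {V : Type*} [NormedAddCommGroup V] [NormedSpace ℂ V] (Λ : Submodule ℤ V)

/-- The `ℚ`-linear extension to `H₁(A, ℚ)` of a class in `H¹(A, ℂ)`. -/
def cohC1ToHom : torusCohC1 Λ →ₗ[ℂ] (torusH1Q Λ →ₗ[ℚ] ℂ) where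
  toFun f := TensorProduct.AlgebraTensorModule.lift (LinearMap.toSpanSingleton ℚ (Λ →ₗ[ℤ] ℂ) f)
  map_add' f g := by ext v; simp
  map_smul' c f := by ext v; simp

@[simp]
theorem cohC1ToHom_tmul (f : torusCohC1 Λ) (q : ℚ) (v : Λ) :
    cohC1ToHom Λ f (q ⊗ₜ v) = q • f v := by
  simp [cohC1ToHom]

theorem cohC1ToHom_cohQ1ToC1 (φ : torusCohQ1 Λ) (h : torusH1Q Λ) :
    cohC1ToHom Λ (cohQ1ToC1 Λ φ) h = (φ h : ℂ) := by
  induction h using TensorProduct.induction_on with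
  | zero => simp
  | add x y hx hy => simp [hx, hy]
  | tmul q v =>
    have : q ⊗ₜ[ℤ] v = q • (1 : ℚ) ⊗ₜ[ℤ] v := by simp [TensorProduct.smul_tmul']
    rw [this, map_smul, map_smul]
    simp [cohQ1ToC1, Rat.smul_def]

/-- The action of `End(A) ⊗ ℚ` on `H¹(A, ℂ)` by pullback. -/
def cohC1Action : torusEndQ Λ →ₗ[ℚ] Module.End ℂ (torusCohC1 Λ) where
  toFun x :=
    { toFun := fun f => ((cohC1ToHom Λ f ∘ₗ rationalRep Λ x).restrictScalars ℤ) ∘ₗ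
        TensorProduct.mk ℤ ℚ Λ 1
      map_add' := fun f g => LinearMap.ext fun v => by
        change cohC1ToHom Λ (f + g) _ = cohC1ToHom Λ f _ + cohC1ToHom Λ g _
        rw [map_add, LinearMap.add_apply]
      map_smul' := fun c f => LinearMap.ext fun v => by
        change cohC1ToHom Λ (c • f) _ = c • cohC1ToHom Λ f _
        rw [map_smul, LinearMap.smul_apply] }
  map_add' x y := LinearMap.ext fun f => LinearMap.ext fun v => by
    change cohC1ToHom Λ f (rationalRep Λ (x + y) _) =
      cohC1ToHom Λ f (rationalRep Λ x _) + cohC1ToHom Λ f (rationalRep Λ y _)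
    rw [map_add, LinearMap.add_apply, map_add]
  map_smul' q x := LinearMap.ext fun f => LinearMap.ext fun v => by
    change cohC1ToHom Λ f (rationalRep Λ (q • x) _) = q • cohC1ToHom Λ f (rationalRep Λ x _)
    rw [map_smul, LinearMap.smul_apply, map_smul]

theorem cohC1Action_apply (x : torusEndQ Λ) (f : torusCohC1 Λ) (v : Λ) :
    cohC1Action Λ x f v = cohC1ToHom Λ f (rationalRep Λ x (1 ⊗ₜ v)) := rfl

theorem cohC1ToHom_cohC1Action (x : torusEndQ Λ) (f : torusCohC1 Λ) :
    cohC1ToHom Λ (cohC1Action Λ x f) = cohC1ToHom Λ f ∘ₗ rationalRep Λ x := by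
  ext v
  simp [cohC1Action_apply]

theorem cohC1Action_one : cohC1Action Λ 1 = 1 := by
  ext f v
  simp [cohC1Action_apply]

theorem cohC1Action_mul (x y : torusEndQ Λ) :
    cohC1Action Λ (x * y) = cohC1Action Λ y * cohC1Action Λ x := by
  ext f v
  rw [Module.End.mul_apply, cohC1Action_apply, cohC1Action_apply, cohC1ToHom_cohC1Action, map_mul]
  rfl

theorem cohC1Action_cohQ1ToC1 (x : torusEndQ Λ) (φ : torusCohQ1 Λ) :
    cohC1Action Λ x (cohQ1ToC1 Λ φ) = cohQ1ToC1 Λ ((rationalRep Λ x).dualMap φ) := by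
  ext v
  rw [cohC1Action_apply, cohC1ToHom_cohQ1ToC1]
  rfl

theorem cohC1Action_tmul (q : ℚ) (φ : torusEnd Λ) (f : torusCohC1 Λ) (v : Λ) :
    cohC1Action Λ (q ⊗ₜ φ) f v = q • f ⟨φ.1 v, φ.2 v v.2⟩ := by
  rw [cohC1Action_apply]
  have : rationalRep Λ (q ⊗ₜ φ) (1 ⊗ₜ v) = q ⊗ₜ ⟨φ.1 v, φ.2 v v.2⟩ := by
    rw [rationalRep]
    change q • ((1 : ℚ) ⊗ₜ[ℤ] (⟨φ.1 v, φ.2 v v.2⟩ : Λ)) = _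
    rw [TensorProduct.smul_tmul', smul_eq_mul, mul_one]
  rw [this, cohC1ToHom_tmul]

/-- Endomorphisms of the torus are `ℂ`-linear on `V`, so composing with them preserves `ℂ`-linear
functionals. -/
theorem cohC1Action_mem_hodge10 (x : torusEndQ Λ) {f : torusCohC1 Λ} (hf : f ∈ hodge10 Λ) :
    cohC1Action Λ x f ∈ hodge10 Λ := by
  induction x using TensorProduct.induction_on with
  | zero => simp
  | add x y hx hy => rw [map_add]; exact add_mem hx hy
  | tmul q φ =>
    obtain ⟨g, hg⟩ := hf
    refine ⟨(q : ℂ) • g ∘ₗ φ.1, fun v => ?_⟩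
    rw [cohC1Action_tmul, hg]
    simp [Rat.smul_def]

theorem cohC1Action_mem_hodge01 (x : torusEndQ Λ) {f : torusCohC1 Λ} (hf : f ∈ hodge01 Λ) :
    cohC1Action Λ x f ∈ hodge01 Λ := by
  induction x using TensorProduct.induction_on with
  | zero => simp
  | add x y hx hy => rw [map_add]; exact add_mem hx hy
  | tmul q φ =>
    obtain ⟨g, hg⟩ := hf
    refine ⟨(q : ℂ) • g.comp φ.1, fun v => ?_⟩
    rw [cohC1Action_tmul, hg]
    simp [Rat.smul_def]

theorem cohQToC_ιMulti (k : ℕ) (v : Fin k → torusCohQ1 Λ) :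
    cohQToC Λ k (exteriorPower.ιMulti ℚ k v) =
      exteriorPower.ιMulti ℂ k fun i => cohQ1ToC1 Λ (v i) := by
  rw [cohQToC, exteriorPower.alternatingMapLinearEquiv_apply_ιMulti]
  rfl

theorem cohQToC_cohAction (k : ℕ) (x : torusEndQ Λ) (w : torusCohQ Λ k) :
    cohQToC Λ k (cohAction k x w) = exteriorPower.map k (cohC1Action Λ x) (cohQToC Λ k w) := by
  have : cohQToC Λ k ∘ₗ cohAction k x =
      (exteriorPower.map k (cohC1Action Λ x)).restrictScalars ℚ ∘ₗ cohQToC Λ k := by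
    apply exteriorPower.linearMap_ext
    ext v : 1
    simp only [LinearMap.compAlternatingMap_apply, LinearMap.comp_apply, cohAction,
      exteriorPower.map_apply_ιMulti, cohQToC_ιMulti, LinearMap.restrictScalars_apply]
    congr 1
    ext i : 1
    exact (cohC1Action_cohQ1ToC1 Λ x (v i)).symm
  exact LinearMap.congr_fun this w

variable [FiniteDimensional ℂ V] [DiscreteTopology Λ] [IsZLattice ℝ Λ]

/-- Both bases are dual to one `ℤ`-basis of the lattice. -/
theorem exists_basis_cohQ1_cohC1 :
    ∃ (b : Module.Basis (Fin (Module.finrank ℤ Λ)) ℚ (torusCohQ1 Λ))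
      (b' : Module.Basis (Fin (Module.finrank ℤ Λ)) ℂ (torusCohC1 Λ)),
      ∀ i, cohQ1ToC1 Λ (b i) = b' i := by
  have : FiniteDimensional ℝ V := FiniteDimensional.complexToReal V
  have : Module.Free ℤ Λ := ZLattice.module_free ℝ Λ
  have : Module.Finite ℤ Λ := ZLattice.module_finite ℝ Λ
  let c := Module.finBasis ℤ Λ
  let b' : Module.Basis (Fin (Module.finrank ℤ Λ)) ℂ (torusCohC1 Λ) :=
    Module.Basis.ofEquivFun (c.constr ℂ).symm
  refine ⟨(c.baseChange ℚ).dualBasis, b', fun i => c.ext fun j => ?_⟩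
  have h1 : b' i (c j) = if i = j then 1 else 0 := by
    simp [b', Pi.single_apply, eq_comm]
  rw [h1]
  have h2 : ((1 : ℚ) ⊗ₜ[ℤ] c j) = c.baseChange ℚ j := by simp
  change ((c.baseChange ℚ).dualBasis i ((1 : ℚ) ⊗ₜ[ℤ] c j) : ℂ) = _
  rw [h2, Module.Basis.dualBasis_apply_self]
  rcases eq_or_ne i j with h | h
  · simp [h]
  · simp [h, h.symm]

theorem isBaseChange_cohQToC (k : ℕ) : IsBaseChange ℂ (cohQToC Λ k) := by
  obtain ⟨b, b', h⟩ := exists_basis_cohQ1_cohC1 Λ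
  refine IsBaseChange.of_map_basis (b.exteriorPower k) (b'.exteriorPower k) fun s => ?_
  simp only [exteriorPower.basis_apply, exteriorPower.ιMulti_family, cohQToC_ιMulti]
  congr 1
  ext i : 1
  exact h _

instance : FiniteDimensional ℚ (torusCohQ1 Λ) :=
  let ⟨b, _⟩ := exists_basis_cohQ1_cohC1 Λ
  Module.Finite.of_basis b

instance : FiniteDimensional ℂ (torusCohC1 Λ) :=
  let ⟨_, b', _⟩ := exists_basis_cohQ1_cohC1 Λ
  Module.Finite.of_basis b'

theorem finrank_torusCohC1 : Module.finrank ℂ (torusCohC1 Λ) = 2 * Module.finrank ℂ V := by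
  have : FiniteDimensional ℝ V := FiniteDimensional.complexToReal V
  obtain ⟨_, b', _⟩ := exists_basis_cohQ1_cohC1 Λ
  rw [Module.finrank_eq_card_basis b', Fintype.card_fin, ZLattice.rank ℝ Λ,
    finrank_real_of_complex]

theorem real_linear_ext {g g' : V →ₗ[ℝ] ℂ} (h : ∀ v : Λ, g v = g' v) : g = g' :=
  LinearMap.ext_on (IsZLattice.span_top (K := ℝ) (L := Λ)) fun v hv => h ⟨v, hv⟩

/-- A conjugate-linear functional as a real-linear map. -/
def conjLinearToReal (g : V →ₛₗ[starRingEnd ℂ] ℂ) : V →ₗ[ℝ] ℂ where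
  toFun := g
  map_add' := g.map_add
  map_smul' r v := by
    rw [← Complex.coe_smul, g.map_smulₛₗ]
    simp

/-- The lattice spans `V` over `ℝ`, so a common element comes from one functional that is both
linear and conjugate-linear; evaluating it at `i v` shows that it vanishes. -/
theorem disjoint_hodge : Disjoint (hodge10 Λ) (hodge01 Λ) := by
  rw [Submodule.disjoint_def]
  rintro f ⟨g, hg⟩ ⟨g', hg'⟩
  have h : g.restrictScalars ℝ = conjLinearToReal g' :=
    real_linear_ext Λ fun v => (hg v).symm.trans (hg' v)
  have h' : ∀ v, g v = g' v := fun v => LinearMap.congr_fun h v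
  ext v
  have h1 := h' (Complex.I • (v : V))
  rw [map_smul, g'.map_smulₛₗ, ← h' v, Complex.conj_I, smul_eq_mul, smul_eq_mul, neg_mul,
    eq_neg_iff_add_eq_zero, ← two_mul] at h1
  simpa [hg] using h1

theorem finrank_le_finrank_hodge10 : Module.finrank ℂ V ≤ Module.finrank ℂ (hodge10 Λ) := by
  let c := Module.finBasis ℂ V
  let f : Fin (Module.finrank ℂ V) → torusCohC1 Λ := fun i =>
    ((c.coord i).restrictScalars ℤ) ∘ₗ Λ.subtype
  have hf : LinearIndependent ℂ f := by
    rw [Fintype.linearIndependent_iff]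
    intro r hr i
    have h1 : (∑ j, r j • c.coord j).restrictScalars ℝ = 0 := by
      refine real_linear_ext Λ fun v => ?_
      simpa [f] using LinearMap.congr_fun hr v
    simpa [Finsupp.single_apply] using LinearMap.congr_fun h1 (c i)
  rw [← Fintype.card_fin (Module.finrank ℂ V), ← finrank_span_eq_card hf]
  apply Submodule.finrank_mono
  rw [Submodule.span_le]
  rintro _ ⟨i, rfl⟩
  exact ⟨c.coord i, fun v => rfl⟩

theorem finrank_le_finrank_hodge01 : Module.finrank ℂ V ≤ Module.finrank ℂ (hodge01 Λ) := by
  let c := Module.finBasis ℂ V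
  let g : Fin (Module.finrank ℂ V) → V →ₛₗ[starRingEnd ℂ] ℂ := fun i =>
    { toFun := fun v => starRingEnd ℂ (c.coord i v)
      map_add' := fun v w => by simp
      map_smul' := fun z v => by simp }
  let f : Fin (Module.finrank ℂ V) → torusCohC1 Λ := fun i =>
    ((conjLinearToReal (g i)).restrictScalars ℤ) ∘ₗ Λ.subtype
  have hf : LinearIndependent ℂ f := by
    rw [Fintype.linearIndependent_iff]
    intro r hr i
    have h1 : ∑ j, r j • conjLinearToReal (g j) = 0 := by
      refine real_linear_ext Λ fun v => ?_
      simpa [f] using LinearMap.congr_fun hr v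
    simpa [Finsupp.single_apply, conjLinearToReal, g, apply_ite] using LinearMap.congr_fun h1 (c i)
  rw [← Fintype.card_fin (Module.finrank ℂ V), ← finrank_span_eq_card hf]
  apply Submodule.finrank_mono
  rw [Submodule.span_le]
  rintro _ ⟨i, rfl⟩
  exact ⟨g i, fun v => rfl⟩

/-- Two disjoint subspaces, each of dimension at least `dim V`, sit in a space of dimension `2 dim
V`. -/
theorem finrank_hodge : Module.finrank ℂ (hodge10 Λ) = Module.finrank ℂ V ∧
    Module.finrank ℂ (hodge01 Λ) = Module.finrank ℂ V := by
  have h1 := finrank_le_finrank_hodge10 Λ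
  have h2 := finrank_le_finrank_hodge01 Λ
  have h3 := Submodule.finrank_add_finrank_le_of_disjoint (disjoint_hodge Λ)
  rw [finrank_torusCohC1] at h3
  omega

end TorusCohomology

/-! ### Weil classes and quaternion classes after complexification -/

section QuaternionClasses

variable {V : Type*} [NormedAddCommGroup V] [NormedSpace ℂ V] {Λ : Submodule ℤ V}
  {F : Type*} [Ring F] [Algebra ℚ F]

/-- The right action of `F` on `H¹(A, ℂ)`. -/
def pullbackAction (ι : F →ₐ[ℚ] torusEndQ Λ) : F →ₗ[ℚ] Module.End ℂ (torusCohC1 Λ) :=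
  cohC1Action Λ ∘ₗ ι.toLinearMap

theorem isRightAction_pullbackAction (ι : F →ₐ[ℚ] torusEndQ Λ) :
    IsRightAction (pullbackAction ι) where
  map_one := by
    change cohC1Action Λ (ι 1) = 1
    rw [map_one, cohC1Action_one]
  map_mul x y := by
    change cohC1Action Λ (ι (x * y)) = _
    rw [map_mul, cohC1Action_mul]
    rfl

/-- Follows powers under both embeddings `a ↦ ± s`, so that the trace and norm of `x ^ (2 * n)` can
be read off from `(p ± q * s) ^ (2 * n)`. -/
theorem IsQuaternionPair.exists_pow_eq {K : Subalgebra ℚ F} {a b : F} {d : ℚ}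
    (h : IsQuaternionPair K a b d) {s : ℂ} (hs : s * s = d) {x : F} {p q : ℚ}
    (hx : x = p • 1 + q • a) (m : ℕ) :
    ∃ p' q' : ℚ, x ^ m = p' • 1 + q' • a ∧ (p' + q' * s : ℂ) = (p + q * s) ^ m ∧
      (p' - q' * s : ℂ) = (p - q * s) ^ m := by
  induction m with
  | zero => exact ⟨1, 0, by simp, by simp, by simp⟩
  | succ m ih =>
    obtain ⟨p', q', h1, h2, h3⟩ := ih
    refine ⟨p' * p + q' * q * d, p' * q + q' * p, ?_, ?_, ?_⟩
    · rw [pow_succ, h1, hx]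
      simp only [add_mul, mul_add, smul_mul_assoc, mul_smul_comm, h.sq, one_mul, mul_one,
        Algebra.algebraMap_eq_smul_one]
      module
    · rw [pow_succ, ← h2]
      push_cast
      rw [← hs]
      ring
    · rw [pow_succ, ← h3]
      push_cast
      rw [← hs]
      ring

/-- The polynomial `(X - μ) (X - ν)` evaluated at `⋀^k g`. -/
def quadraticAt {E : Type*} [AddCommGroup E] [Module ℂ E] (k : ℕ) (g : Module.End ℂ E) (μ ν : ℂ) :
    Module.End ℂ (⋀[ℂ]^k E) :=
  exteriorPower.map k g ^ 2 - (μ + ν) • exteriorPower.map k g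
    + (μ * ν) • (1 : Module.End ℂ (⋀[ℂ]^k E))

theorem quadraticAt_eq_zero {E : Type*} [AddCommGroup E] [Module ℂ E] {k : ℕ} {g : Module.End ℂ E}
    {μ ν c : ℂ} {v : Fin k → E} (hv : ∀ i, g (v i) = c • v i) (hc : c ^ k = μ ∨ c ^ k = ν) :
    quadraticAt k g μ ν (exteriorPower.ιMulti ℂ k v) = 0 := by
  have h1 : exteriorPower.map k g (exteriorPower.ιMulti ℂ k v) =
      c ^ k • exteriorPower.ιMulti ℂ k v := by
    rw [exteriorPower.map_apply_ιMulti]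
    have : g ∘ v = fun i => c • v i := funext hv
    rw [this, AlternatingMap.map_smul_univ]
    simp
  simp only [quadraticAt, LinearMap.add_apply, LinearMap.sub_apply, LinearMap.smul_apply, pow_two,
    Module.End.mul_apply, h1, map_smul, Module.End.one_apply]
  rcases hc with hc | hc <;> rw [hc] <;> module

variable (ι : F →ₐ[ℚ] torusEndQ Λ) (n : ℕ)

theorem cohAction_mul (k : ℕ) (x y : torusEndQ Λ) (w : torusCohQ Λ k) :
    cohAction k y (cohAction k x w) = cohAction k (x * y) w := by
  rw [← LinearMap.comp_apply, cohAction, cohAction, cohAction, ← exteriorPower.map_comp, map_mul]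
  rfl

variable {ι n}

theorem cohAction_mem_quaternionClasses {K : Subalgebra ℚ F} (x : F)
    {w : torusCohQ Λ (2 * n)} (hw : w ∈ quaternionClasses ι n K) :
    cohAction (2 * n) (ι x) w ∈ quaternionClasses ι n K := by
  have : quaternionClasses ι n K ≤
      (quaternionClasses ι n K).comap (cohAction (2 * n) (ι x)) := by
    refine iSup_le fun y => ?_
    rintro _ ⟨u, hu, rfl⟩
    refine Submodule.mem_iSup_of_mem (y * x) ⟨u, hu, ?_⟩
    rw [cohAction_mul, map_mul]
  exact this hw

/-- With the preceding stability, `W_F` is the smallest `F`-stable subspace containing `W_K`;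
comparing two fields reduces to placing the Weil classes of one in the `W_F` of the other. -/
theorem quaternionClasses_le {K : Subalgebra ℚ F} {S : Submodule ℚ (torusCohQ Λ (2 * n))}
    (hS : ∀ x : F, ∀ w ∈ S, cohAction (2 * n) (ι x) w ∈ S) (h : weilClasses ι n K ≤ S) :
    quaternionClasses ι n K ≤ S := by
  refine iSup_le fun x => ?_
  rintro _ ⟨u, hu, rfl⟩
  exact hS x u (h hu)

variable [FiniteDimensional ℂ V] [DiscreteTopology Λ] [IsZLattice ℝ Λ]

/-- Over `ℂ` the defining quadratic splits with roots `(p ± q * s) ^ (2 * n)`, and kernels commute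
with base change. -/
theorem span_cohQToC_weilKernel {K : Subalgebra ℚ F} {a b : F} {d : ℚ}
    (h : IsQuaternionPair K a b d) {s : ℂ} (hs : s * s = d) (x : K) {p q : ℚ}
    (hx : (x : F) = p • 1 + q • a) :
    Submodule.span ℂ (cohQToC Λ (2 * n) '' weilKernel ι n K x) =
      LinearMap.ker (quadraticAt (2 * n) (pullbackAction ι x) ((p + q * s) ^ (2 * n))
        ((p - q * s) ^ (2 * n))) := by
  refine (isBaseChange_cohQToC Λ (2 * n)).span_image_ker fun w => ?_
  obtain ⟨p', q', h1, h2, h3⟩ := h.exists_pow_eq hs hx (2 * n)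
  obtain ⟨htr, hdet⟩ := h.trace_det_mulLeft (x ^ (2 * n)) (p := p') (q := q') (by simpa using h1)
  have htr' : (p + q * s) ^ (2 * n) + (p - q * s) ^ (2 * n) = ((2 * p' : ℚ) : ℂ) := by
    rw [← h2, ← h3]
    push_cast
    ring
  have hdet' : (p + q * s) ^ (2 * n) * (p - q * s) ^ (2 * n) = ((p' ^ 2 - q' ^ 2 * d : ℚ) : ℂ) := by
    rw [← h2, ← h3]
    push_cast
    rw [← hs]
    ring
  rw [htr, hdet, quadraticAt, htr', hdet']
  have hc : ∀ w, exteriorPower.map (2 * n) (pullbackAction ι (x : F)) (cohQToC Λ (2 * n) w) =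
      cohQToC Λ (2 * n) (cohAction (2 * n) (ι x) w) := fun w =>
    (cohQToC_cohAction Λ (2 * n) (ι x) w).symm
  simp only [LinearMap.add_apply, LinearMap.sub_apply, LinearMap.smul_apply, pow_two,
    Module.End.mul_apply, Module.End.one_apply, hc, map_add, map_sub, map_smul,
    Rat.cast_smul_eq_qsmul]

/-- After complexification, the Weil classes are spanned by the two extremal vectors. -/
theorem span_cohQToC_weilClasses {K : Subalgebra ℚ F} {a b : F} {d : ℚ}
    (h : IsQuaternionPair K a b d) {s : ℂ} (hs : s * s = d) (hs0 : s ≠ 0)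
    (B : Module.Basis (Fin (2 * n) ⊕ Fin (2 * n)) ℂ (torusCohC1 Λ))
    (he : ∀ i, pullbackAction ι a (B (.inl i)) = s • B (.inl i))
    (hf : ∀ i, pullbackAction ι a (B (.inr i)) = (-s) • B (.inr i)) :
    Submodule.span ℂ (cohQToC Λ (2 * n) '' weilClasses ι n K) =
      Submodule.span ℂ {exteriorPower.ιMulti ℂ (2 * n) fun i => B (.inl i),
        exteriorPower.ιMulti ℂ (2 * n) fun i => B (.inr i)} := by
  have hT := isRightAction_pullbackAction ι
  have hxe : ∀ (x : F) (p q : ℚ), x = p • 1 + q • a →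
      ∀ i, pullbackAction ι x (B (.inl i)) = (p + q * s : ℂ) • B (.inl i) := by
    rintro _ p q rfl i
    simp only [map_add, map_smul, hT.map_one, LinearMap.add_apply, LinearMap.smul_apply,
      Module.End.one_apply, he, ← Rat.cast_smul_eq_qsmul ℂ]
    module
  have hxf : ∀ (x : F) (p q : ℚ), x = p • 1 + q • a →
      ∀ i, pullbackAction ι x (B (.inr i)) = (p - q * s : ℂ) • B (.inr i) := by
    rintro _ p q rfl i
    simp only [map_add, map_smul, hT.map_one, LinearMap.add_apply, LinearMap.smul_apply,
      Module.End.one_apply, hf, ← Rat.cast_smul_eq_qsmul ℂ]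
    module
  have hge : ∀ x : K, Submodule.span ℂ {exteriorPower.ιMulti ℂ (2 * n) fun i => B (.inl i),
        exteriorPower.ιMulti ℂ (2 * n) fun i => B (.inr i)} ≤
      Submodule.span ℂ (cohQToC Λ (2 * n) '' weilKernel ι n K x) := by
    intro x
    obtain ⟨p, q, hx⟩ := h.exists_of_mem x x.2
    rw [span_cohQToC_weilKernel h hs x hx, Submodule.span_le, Set.insert_subset_iff,
      Set.singleton_subset_iff]
    exact ⟨quadraticAt_eq_zero (hxe x p q hx) (.inl rfl),
      quadraticAt_eq_zero (hxf x p q hx) (.inr rfl)⟩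
  obtain ⟨t, ht1, ht2, ht3⟩ := exists_rat_pow_ne hs0 (2 * n)
  let x₀ : K := ⟨t • 1 + (1 : ℚ) • a,
    K.add_mem (K.smul_mem K.one_mem t) (K.smul_mem h.mem 1)⟩
  have hle : Submodule.span ℂ (cohQToC Λ (2 * n) '' weilKernel ι n K x₀) ≤
      Submodule.span ℂ {exteriorPower.ιMulti ℂ (2 * n) fun i => B (.inl i),
        exteriorPower.ιMulti ℂ (2 * n) fun i => B (.inr i)} := by
    rw [span_cohQToC_weilKernel h hs x₀ rfl, quadraticAt]
    refine ker_map_eigen_le B ?_ ?_ ?_ (hxe x₀ t 1 rfl) (hxf x₀ t 1 rfl)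
    · simpa using ht1
    · simpa using ht2
    · simpa using ht3
  -- Intersections are not compared over `ℂ`: the single `x₀ = t + a` already cuts out `W_K`, since
  -- every `W_x` contains the extremal vectors after complexification.
  have heq : weilClasses ι n K = weilKernel ι n K x₀ :=
    le_antisymm (iInf_le _ x₀) (le_iInf fun x =>
      (isBaseChange_cohQToC Λ (2 * n)).le_of_span_image_le (hle.trans (hge x)))
  rw [heq]
  exact le_antisymm hle (hge x₀)

variable {K : Subalgebra ℚ F} {a b : F} {d : ℚ} {s : ℂ} {e : Fin (2 * n) → torusCohC1 Λ}

theorem span_cohQToC_weilClasses_of_eigenvectors (h : IsQuaternionPair K a b d) (hs : s * s = d)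
    (hV : Module.finrank ℂ V = 2 * n) (hli : LinearIndependent ℂ e)
    (he : ∀ i, pullbackAction ι a (e i) = s • e i) :
    Submodule.span ℂ (cohQToC Λ (2 * n) '' weilClasses ι n K) =
      Submodule.span ℂ {exteriorPower.ιMulti ℂ (2 * n) e,
        exteriorPower.ιMulti ℂ (2 * n) fun i => pullbackAction ι b (e i)} := by
  have hT := isRightAction_pullbackAction ι
  have hs0 : s ≠ 0 := by
    rintro rfl
    exact h.ne_zero (by simpa using hs.symm)
  obtain ⟨B, hBe, hBf⟩ := hT.exists_basis h hs0 (by rw [finrank_torusCohC1, hV]; ring) hli he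
  have := span_cohQToC_weilClasses h hs hs0 B (fun i => by rw [hBe, he])
    (fun i => by rw [hBf, hT.apply_anticomm h, he, map_smul, neg_smul])
  simpa only [hBe, hBf] using this

/-- After complexification, the quaternion classes are spanned by the pencil through the two extremal
vectors. -/
theorem span_cohQToC_quaternionClasses (h : IsQuaternionPair K a b d) (hs : s * s = d)
    (hV : Module.finrank ℂ V = 2 * n) (hli : LinearIndependent ℂ e)
    (he : ∀ i, pullbackAction ι a (e i) = s • e i) :
    Submodule.span ℂ (cohQToC Λ (2 * n) '' quaternionClasses ι n K) =
      pencilSpan e fun i => pullbackAction ι b (e i) := by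
  have hT := isRightAction_pullbackAction ι
  have hW := span_cohQToC_weilClasses_of_eigenvectors h hs hV hli he
  have hact : ∀ x w, exteriorPower.map (2 * n) (pullbackAction ι x) (cohQToC Λ (2 * n) w) =
      cohQToC Λ (2 * n) (cohAction (2 * n) (ι x) w) := fun x w =>
    (cohQToC_cohAction Λ (2 * n) (ι x) w).symm
  apply le_antisymm
  · have h1 : quaternionClasses ι n K ≤ ((pencilSpan e fun i => pullbackAction ι b (e i)).restrictScalars
        ℚ).comap (cohQToC Λ (2 * n)) := by
      refine iSup_le fun x => ?_
      rintro _ ⟨w, hw, rfl⟩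
      have h2 : cohQToC Λ (2 * n) w ∈ Submodule.span ℂ {exteriorPower.ιMulti ℂ (2 * n) e,
          exteriorPower.ιMulti ℂ (2 * n) fun i => pullbackAction ι b (e i)} := by
        rw [← hW]
        exact Submodule.subset_span ⟨w, hw, rfl⟩
      obtain ⟨u, v, huv⟩ := Submodule.mem_span_pair.1 h2
      obtain ⟨α, β, hαβ⟩ := hT.exists_coeff h he x
      obtain ⟨γ, δ, hγδ⟩ := hT.exists_coeff' h he x
      change cohQToC Λ (2 * n) (cohAction (2 * n) (ι x) w) ∈ pencilSpan _ _
      rw [← hact, ← huv, map_add, map_smul, map_smul, exteriorPower.map_pencil hαβ,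
        exteriorPower.map_pencil hγδ]
      exact add_mem (Submodule.smul_mem _ _ (pencil_mem_pencilSpan _ _ _ _))
        (Submodule.smul_mem _ _ (pencil_mem_pencilSpan _ _ _ _))
    rw [Submodule.span_le]
    rintro _ ⟨w, hw, rfl⟩
    exact h1 hw
  -- The elements `1 + t • b` of `F` carry `⋀ eᵢ` to the members with parameters `(1, t)`, `t`
  -- rational, which suffice.
  · refine pencilSpan_le_of_infinite _ _
      (Set.infinite_range_of_injective (Rat.cast_injective (α := ℂ))) ?_
    rintro _ ⟨t, rfl⟩
    have h1 : ∀ i, pullbackAction ι (1 + t • b) (e i) =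
        (1 : ℂ) • e i + (t : ℂ) • pullbackAction ι b (e i) := by
      intro i
      simp [hT.map_one, ← Rat.cast_smul_eq_qsmul ℂ]
    rw [← exteriorPower.map_pencil h1]
    have h2 : exteriorPower.ιMulti ℂ (2 * n) e ∈
        Submodule.span ℂ (cohQToC Λ (2 * n) '' weilClasses ι n K) := by
      rw [hW]
      exact Submodule.subset_span (by simp)
    have h3 : Submodule.span ℂ (cohQToC Λ (2 * n) '' weilClasses ι n K) ≤
        (Submodule.span ℂ (cohQToC Λ (2 * n) '' quaternionClasses ι n K)).comap
          (exteriorPower.map (2 * n) (pullbackAction ι (1 + t • b))) := by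
      rw [Submodule.span_le]
      rintro _ ⟨w, hw, rfl⟩
      refine Submodule.subset_span ⟨_, ?_, (hact _ w).symm⟩
      exact Submodule.mem_iSup_of_mem (1 + t • b) ⟨w, hw, rfl⟩
    exact h3 h2

/-- An adapted basis for one quadratic subfield yields one for any other, with all members in the same
pencil. -/
theorem weilClasses_le_quaternionClasses (h : IsQuaternionPair K a b d) (hs : s * s = d)
    (hV : Module.finrank ℂ V = 2 * n) (hli : LinearIndependent ℂ e)
    (he : ∀ i, pullbackAction ι a (e i) = s • e i) {K' : Subalgebra ℚ F} {a' b' : F} {d' : ℚ}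
    (h' : IsQuaternionPair K' a' b' d') : weilClasses ι n K' ≤ quaternionClasses ι n K := by
  have hT := isRightAction_pullbackAction ι
  set f := fun i => pullbackAction ι b (e i) with hf
  obtain ⟨s', hs'⟩ := (IsAlgClosed.exists_eq_mul_self (d' : ℂ)).imp fun _ h => h.symm
  have hs0 : s ≠ 0 := by
    rintro rfl
    exact h.ne_zero (by simpa using hs.symm)
  have hs0' : s' ≠ 0 := by
    rintro rfl
    exact h'.ne_zero (by simpa using hs'.symm)
  obtain ⟨B, hBe, hBf⟩ := hT.exists_basis h hs0 (by rw [finrank_torusCohC1, hV]; ring) hli he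
  have hcoef : ∀ (x : F) (α β : ℂ), ∃ γ δ : ℂ, ∀ i,
      pullbackAction ι x (α • e i + β • f i) = γ • e i + δ • f i := by
    intro x α β
    obtain ⟨α₁, β₁, h1⟩ := hT.exists_coeff h he x
    obtain ⟨α₂, β₂, h2⟩ := hT.exists_coeff' h he x
    refine ⟨α * α₁ + β * α₂, α * β₁ + β * β₂, fun i => ?_⟩
    simp only [hf, map_add, map_smul, h1, h2]
    module
  -- Since `a'² = s'²`, the operator `a' + s'` maps into the `s'`-eigenspace of `a'`.
  have hproj : ∀ v, pullbackAction ι a' (pullbackAction ι a' v + s' • v) =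
      s' • (pullbackAction ι a' v + s' • v) := by
    intro v
    rw [map_add, map_smul, hT.apply_apply h' hs']
    module
  obtain ⟨α, β, hαβ, heig⟩ : ∃ α β : ℂ, (α ≠ 0 ∨ β ≠ 0) ∧ ∀ i,
      pullbackAction ι a' (α • e i + β • f i) = s' • (α • e i + β • f i) := by
    have key : ∀ u v : ℂ, ∃ α β : ℂ, ∀ i, α • e i + β • f i =
        pullbackAction ι a' (u • e i + v • f i) + s' • (u • e i + v • f i) := by
      intro u v
      obtain ⟨γ, δ, h1⟩ := hcoef a' u v
      exact ⟨γ + s' * u, δ + s' * v, fun i => by rw [h1]; module⟩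
    obtain ⟨α₁, β₁, h1⟩ := key 1 0
    obtain ⟨α₂, β₂, h2⟩ := key 0 1
    by_cases hz1 : α₁ ≠ 0 ∨ β₁ ≠ 0
    · exact ⟨α₁, β₁, hz1, fun i => by rw [h1, hproj]⟩
    by_cases hz2 : α₂ ≠ 0 ∨ β₂ ≠ 0
    · exact ⟨α₂, β₂, hz2, fun i => by rw [h2, hproj]⟩
    push Not at hz1 hz2
    -- If `a' + s'` kills both `e i` and `f i` for every `i`, then `a'` acts as a scalar, which
    -- cannot anticommute with the invertible `b'`. For `n = 0` there is no basis vector to yield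
    -- this, but the eigenvector condition is vacuous.
    have hall : pullbackAction ι a' = (-s') • 1 := by
      refine B.ext ?_
      rintro (i | i)
      · have := h1 i
        simp only [hz1, zero_smul, one_smul, add_zero] at this
        simpa [hBe] using eq_neg_of_add_eq_zero_left this.symm
      · have := h2 i
        simp only [hz2, zero_smul, one_smul, zero_add, add_zero] at this
        simpa [hBf, hf] using eq_neg_of_add_eq_zero_left this.symm
    rcases n with _ | n
    · exact ⟨1, 0, by simp, fun i => i.elim0⟩
    · exfalso
      have h3 := hT.apply_anticomm h' (B (.inl ⟨0, by omega⟩))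
      rw [hall] at h3
      have h4 : (2 * s') • pullbackAction ι b' (B (.inl ⟨0, by omega⟩)) = 0 := by
        simp only [LinearMap.smul_apply, Module.End.one_apply, map_smul] at h3
        calc _ = -((-s') • pullbackAction ι b' (B (.inl ⟨0, by omega⟩))) -
              (-s') • pullbackAction ι b' (B (.inl ⟨0, by omega⟩)) := by module
          _ = 0 := by rw [← h3, sub_self]
      have h5 := (smul_eq_zero.1 h4).resolve_left (mul_ne_zero two_ne_zero hs0')
      exact B.ne_zero _ (hT.injective h'.isUnit (h5.trans (map_zero _).symm))
  have hli' : LinearIndependent ℂ fun i => α • e i + β • f i := by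
    have hB := B.linearIndependent
    rw [Fintype.linearIndependent_iff] at hB ⊢
    intro c hc i
    have h1 : ∑ j, Sum.elim (fun i => c i * α) (fun i => c i * β) j • B j = 0 := by
      rw [Fintype.sum_sum_type, ← Finset.sum_add_distrib, ← hc]
      refine Finset.sum_congr rfl fun i _ => ?_
      simp only [Sum.elim_inl, Sum.elim_inr, hBe, hBf, hf]
      module
    have h2 := hB _ h1 (.inl i)
    have h3 := hB _ h1 (.inr i)
    simp only [Sum.elim_inl, Sum.elim_inr] at h2 h3
    rcases hαβ with hα | hβ
    · exact (mul_eq_zero.1 h2).resolve_right hα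
    · exact (mul_eq_zero.1 h3).resolve_right hβ
  apply (isBaseChange_cohQToC Λ (2 * n)).le_of_span_image_le
  rw [span_cohQToC_weilClasses_of_eigenvectors h' hs' hV hli' heig,
    span_cohQToC_quaternionClasses h hs hV hli he, Submodule.span_le, Set.insert_subset_iff,
    Set.singleton_subset_iff]
  refine ⟨pencil_mem_pencilSpan e f α β, ?_⟩
  obtain ⟨γ, δ, h1⟩ := hcoef b' α β
  simp only [h1]
  exact pencil_mem_pencilSpan e f γ δ

theorem exists_hodge_eigenvectors (h : IsQuaternionPair K a b d) (hs : s * s = d)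
    (hV : Module.finrank ℂ V = 2 * n) :
    ∃ e : Fin (2 * n) → torusCohC1 Λ, LinearIndependent ℂ e ∧
      (∀ i, pullbackAction ι a (e i) = s • e i) ∧
      (∀ i : Fin (2 * n), (i : ℕ) < n → e i ∈ hodge10 Λ) ∧
      (∀ i : Fin (2 * n), n ≤ (i : ℕ) → e i ∈ hodge01 Λ) := by
  have hT := isRightAction_pullbackAction ι
  have hs0 : s ≠ 0 := by
    rintro rfl
    exact h.ne_zero (by simpa using hs.symm)
  obtain ⟨h10, h01⟩ := finrank_hodge Λ
  exact exists_eigenvectors_of_disjoint hs0 (hT.apply_apply h hs) (hT.apply_anticomm h)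
    (hT.injective h.isUnit) (disjoint_hodge Λ)
    (fun v hv => cohC1Action_mem_hodge10 Λ (ι a) hv) (fun v hv => cohC1Action_mem_hodge10 Λ (ι b) hv)
    (fun v hv => cohC1Action_mem_hodge01 Λ (ι a) hv) (fun v hv => cohC1Action_mem_hodge01 Λ (ι b) hv)
    (h10.trans hV) (h01.trans hV)

end QuaternionClasses
end

theorem proposition4p7 {V : Type*} [NormedAddCommGroup V] [NormedSpace ℂ V] [FiniteDimensional ℂ V]
    (Λ : Submodule ℤ V) [DiscreteTopology Λ] [IsZLattice ℝ Λ]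
    (E : Polarization Λ)
    {F : Type*} [Ring F] [Algebra ℚ F] (ι : F →ₐ[ℚ] torusEndQ Λ)
    (hA : IsQuaternionType E ι)
    (n : ℕ) (hn : Module.finrank ℂ V = 2 * n) :
    (∀ K K' : Subalgebra ℚ F, IsQuadraticSubfield K → IsQuadraticSubfield K' →
      quaternionClasses ι n K = quaternionClasses ι n K') ∧
    (∀ K : Subalgebra ℚ F, IsQuadraticSubfield K →
      (∀ w ∈ quaternionClasses ι n K,
        cohQToC Λ (2 * n) w ∈ hodgePiece Λ n n (two_mul n).symm) ∧
      Module.finrank ℚ (quaternionClasses ι n K) = 2 * n + 1) := by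
  have hle : ∀ K K' : Subalgebra ℚ F, IsQuadraticSubfield K → IsQuadraticSubfield K' →
      quaternionClasses ι n K' ≤ quaternionClasses ι n K := by
    intro K K' hK hK'
    obtain ⟨a, b, d, h⟩ := exists_isQuaternionPair hA.definite hK
    obtain ⟨a', b', d', h'⟩ := exists_isQuaternionPair hA.definite hK'
    obtain ⟨s, hs⟩ := (IsAlgClosed.exists_eq_mul_self (d : ℂ)).imp fun _ h => h.symm
    obtain ⟨e, hli, he, -, -⟩ := exists_hodge_eigenvectors (ι := ι) h hs hn
    exact quaternionClasses_le (fun x w hw => cohAction_mem_quaternionClasses x hw)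
      (weilClasses_le_quaternionClasses h hs hn hli he h')
  refine ⟨fun K K' hK hK' => le_antisymm (hle K' K hK' hK) (hle K K' hK hK'), fun K hK => ?_⟩
  obtain ⟨a, b, d, h⟩ := exists_isQuaternionPair hA.definite hK
  obtain ⟨s, hs⟩ := (IsAlgClosed.exists_eq_mul_self (d : ℂ)).imp fun _ h => h.symm
  obtain ⟨e, hli, he, h10, h01⟩ := exists_hodge_eigenvectors (ι := ι) h hs hn
  have hspan := span_cohQToC_quaternionClasses h hs hn hli he
  constructor
  · intro w hw
    have h1 : cohQToC Λ (2 * n) w ∈ pencilSpan e fun i => pullbackAction ι b (e i) := by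
      rw [← hspan]
      exact Submodule.subset_span ⟨w, hw, rfl⟩
    refine (Submodule.span_le.2 ?_ : pencilSpan e _ ≤ _) h1
    rintro _ ⟨u, rfl⟩
    -- Each factor `α eᵢ + β (b eᵢ)` has the same Hodge type as `eᵢ`.
    refine Submodule.subset_span ⟨_, fun i hi => ?_, fun i hi => ?_, rfl⟩
    · exact add_mem (Submodule.smul_mem _ _ (h10 i hi))
        (Submodule.smul_mem _ _ (cohC1Action_mem_hodge10 Λ (ι b) (h10 i hi)))
    · exact add_mem (Submodule.smul_mem _ _ (h01 i hi))
        (Submodule.smul_mem _ _ (cohC1Action_mem_hodge01 Λ (ι b) (h01 i hi)))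
  · have hs0 : s ≠ 0 := by
      rintro rfl
      exact h.ne_zero (by simpa using hs.symm)
    obtain ⟨B, hBe, hBf⟩ := (isRightAction_pullbackAction ι).exists_basis h hs0
      (by rw [finrank_torusCohC1, hn]; ring) hli he
    rw [← (isBaseChange_cohQToC Λ (2 * n)).finrank_span_image, hspan]
    have hrank := finrank_pencilSpan B
    rwa [funext hBe, funext hBf] at hrank
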